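/- **Setting.** Let $0<d_1\le\dots\le d_N$, let $N=a_1+\dots+a_n$ with integers $a_k\ge1$, and write $x\in\mathbb R^N=\mathbb R^{a_1}\oplus\dots\oplus\mathbb R^{a_n}$ as $x=(\mathbf x_1,\dots,\mathbf x_n)$. Let $J_k\subset\{1,\dots,N\}$ be the set of indices of the coordinates in $\mathbf x_k$, so that $J_1,\dots,J_n$ are consecutive blocks. For $r>0$ let $r\cdot\mathbf x_k=(r^{d_j}x_j)_{j\in J_k}$, and put $$N_k(\mathbf x_k)=\max_{j\in J_k}|x_j|^{1/d_j},\qquad Q_k=\sum_{j\in J_k}d_j,\qquad [\![\bar\alpha_k]\!]=\sum_{j\in J_k}\alpha_jd_j\quad(\alpha\in\mathbb N^N).$$ For $\psi\in C_0^\infty$ let $\|\psi\|_{(p)}=\sup\{|\partial^\alpha\psi(x)|:|\alpha|\le p,\ x\}$. For $L=\{l_1<\dots<l_r\}\subseteq\{1,\dots,n\}$ let $\mathbb R^L=\mathbb R^{a_{l_1}}\oplus\dots\oplus\mathbb R^{a_{l_r}}$. **Differential inequalities.** A tempered distribution $\mathcal T$ on $\mathbb R^L$ ($L\neq\emptyset$)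 satisfies the differential inequalities with constants $\{C_\alpha\}$ if, on test functions $\varphi\in C_0^\infty(\mathbb R^L)$ supported in $\{\mathbf x_{l_1}\ne0\}$, it is given by integration against a function $T\in C^\infty(\{\mathbf x_{l_1}\neq0\})$ such that, for every multi-index $\alpha$ in the coordinates of $\mathbb R^L$ and all $x$ with $\mathbf x_{l_1}\ne0$, $$|\partial^\alpha T(x)|\le C_\alpha\prod_{i=1}^{r}\Big[N_{l_1}(\mathbf x_{l_1})+\dots+N_{l_i}(\mathbf x_{l_i})\Big]^{-Q_{l_i}-[\![\bar\alpha_{l_i}]\!]}.$$ If $L=\emptyset$, then $\mathcal T$ is a number and the condition is $|\mathcal T|\le C_0$. **Cancellation conditions.** Let $\mathcal K\in\mathcal S'(\mathbb R^N)$, and let $L$ and $M=\{m_1<\dots<m_s\}$ be complementary subsets of $\{1,\dots,n\}$. For $\psi\in C_0^\infty(\mathbb R^M)$ and $R=(R_1,\dots,R_s)\in(0,\infty)^s$ put $\psi_R(\mathbf x_{m_1},\dots,\mathbf x_{m_s})=\psi(R_1\cdot\mathbf x_{m_1},\dots,R_s\cdot\mathbf x_{m_s})$, and let $\mathcal K^\#_{\psi,R}\in\mathcal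 S'(\mathbb R^L)$ be given by $\langle\mathcal K^\#_{\psi,R},\varphi\rangle=\langle\mathcal K,\psi_R\otimes\varphi\rangle$. The cancellation conditions hold for a class of parameters $R$ if for all such $L,M$ and every $\rho>0$ there are constants $C_\alpha$ and integers $p_\alpha\ge 0$ such that, for every $\psi\in C_0^\infty(\mathbb R^M)$ supported in the closed ball of radius $\rho$ about the origin and every $R$ in the class, $\mathcal K^\#_{\psi,R}$ satisfies the differential inequalities on $\mathbb R^L$ with the constants $C_\alpha\|\psi\|_{(p_\alpha)}$, which do not depend on $R$. The distribution $\mathcal K$ is a *flag kernel* (for the standard flag $(0)\subset\mathbb R^{a_n}\subset\mathbb R^{a_{n-1}}\oplus\mathbb R^{a_n}\subset\dots\subset\mathbb R^N$) if it satisfies the differential inequalities on $\mathbb R^N$ with some constants, and the cancellation conditions for all $R\in(0,\infty)^s$. **Theorem.** Let $\mathcal K\in\mathcal S'(\mathbb R^N)$ satisfy the differential inequalities on $\mathbb R^N$ with some constants, and the cancellation conditions for those $R$ with $R_1\ge R_2\ge\dots\ge R_s>0$. Then $\mathcal K$ is a flag kernel. -/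

import Mathlib

open MeasureTheory Set
open scoped SchwartzMap ContDiff

noncomputable section

namespace FlagKernel

/-! ### Tensor products of Schwartz functions -/

section Tensor

variable {E E₁ E₂ : Type*}
  [NormedAddCommGroup E] [NormedSpace ℝ E]
  [NormedAddCommGroup E₁] [NormedSpace ℝ E₁]
  [NormedAddCommGroup E₂] [NormedSpace ℝ E₂]

theorem norm_iteratedFDeriv_comp_clm_le (A : E →L[ℝ] E₁) (f : 𝓢(E₁, ℂ)) (i : ℕ) (x : E) :
    ‖iteratedFDeriv ℝ i (fun y => f (A y)) x‖ ≤ ‖A‖ ^ i * ‖iteratedFDeriv ℝ i f (A x)‖ := by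
  have h := A.iteratedFDeriv_comp_right (f := (f : E₁ → ℂ)) (f.smooth i) x (i := i) le_rfl
  have h' : iteratedFDeriv ℝ i (fun y => f (A y)) x =
      (iteratedFDeriv ℝ i f (A x)).compContinuousLinearMap fun _ => A := h
  rw [h']
  refine (ContinuousMultilinearMap.norm_compContinuousLinearMap_le _ _).trans ?_
  simp [mul_comm]

theorem norm_iteratedFDeriv_tensor_le (A : E →L[ℝ] E₁) (B : E →L[ℝ] E₂)
    (f : 𝓢(E₁, ℂ)) (g : 𝓢(E₂, ℂ)) (hAB : ∀ x, ‖x‖ ≤ ‖A x‖ + ‖B x‖) (k n : ℕ) (x : E) :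
    ‖x‖ ^ k * ‖iteratedFDeriv ℝ n (fun y => f (A y) * g (B y)) x‖ ≤
      ∑ i ∈ Finset.range (n + 1), n.choose i * ‖A‖ ^ i * ‖B‖ ^ (n - i) * 2 ^ k *
        (SchwartzMap.seminorm ℂ k i f * SchwartzMap.seminorm ℂ 0 (n - i) g +
          SchwartzMap.seminorm ℂ 0 i f * SchwartzMap.seminorm ℂ k (n - i) g) := by
  have hf : ContDiff ℝ ∞ (fun y => f (A y)) := (f.smooth ⊤).comp A.contDiff
  have hg : ContDiff ℝ ∞ (fun y => g (B y)) := (g.smooth ⊤).comp B.contDiff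
  have hmul := norm_iteratedFDeriv_mul_le hf hg x (n := n) (mod_cast le_top)
  have hx : ‖x‖ ^ k ≤ 2 ^ k * (‖A x‖ ^ k + ‖B x‖ ^ k) := by
    have h0 : ‖x‖ ≤ 2 * max ‖A x‖ ‖B x‖ := by
      have := hAB x
      have h1 := le_max_left ‖A x‖ ‖B x‖
      have h2 := le_max_right ‖A x‖ ‖B x‖
      linarith
    calc ‖x‖ ^ k ≤ (2 * max ‖A x‖ ‖B x‖) ^ k := by gcongr
      _ = 2 ^ k * (max ‖A x‖ ‖B x‖) ^ k := mul_pow _ _ _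
      _ ≤ 2 ^ k * (‖A x‖ ^ k + ‖B x‖ ^ k) := by
        gcongr
        rcases max_cases ‖A x‖ ‖B x‖ with h | h <;> rw [h.1]
        · have : 0 ≤ ‖B x‖ ^ k := by positivity
          linarith
        · have : 0 ≤ ‖A x‖ ^ k := by positivity
          linarith
  calc ‖x‖ ^ k * ‖iteratedFDeriv ℝ n (fun y => f (A y) * g (B y)) x‖
      ≤ ‖x‖ ^ k * ∑ i ∈ Finset.range (n + 1), (n.choose i : ℝ) *
          ‖iteratedFDeriv ℝ i (fun y => f (A y)) x‖ *
          ‖iteratedFDeriv ℝ (n - i) (fun y => g (B y)) x‖ := by gcongr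
    _ = ∑ i ∈ Finset.range (n + 1), ‖x‖ ^ k * ((n.choose i : ℝ) *
          ‖iteratedFDeriv ℝ i (fun y => f (A y)) x‖ *
          ‖iteratedFDeriv ℝ (n - i) (fun y => g (B y)) x‖) := Finset.mul_sum _ _ _
    _ ≤ _ := by
      refine Finset.sum_le_sum fun i _ => ?_
      have a1 := SchwartzMap.le_seminorm ℂ k i f (A x)
      have a0 := SchwartzMap.le_seminorm ℂ 0 i f (A x)
      have b1 := SchwartzMap.le_seminorm ℂ k (n - i) g (B x)
      have b0 := SchwartzMap.le_seminorm ℂ 0 (n - i) g (B x)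
      simp only [pow_zero, one_mul] at a0 b0
      have cA := norm_iteratedFDeriv_comp_clm_le A f i x
      have cB := norm_iteratedFDeriv_comp_clm_le B g (n - i) x
      calc ‖x‖ ^ k * ((n.choose i : ℝ) * ‖iteratedFDeriv ℝ i (fun y => f (A y)) x‖ *
            ‖iteratedFDeriv ℝ (n - i) (fun y => g (B y)) x‖)
          ≤ (2 ^ k * (‖A x‖ ^ k + ‖B x‖ ^ k)) * ((n.choose i : ℝ) *
            (‖A‖ ^ i * ‖iteratedFDeriv ℝ i f (A x)‖) *
            (‖B‖ ^ (n - i) * ‖iteratedFDeriv ℝ (n - i) g (B x)‖)) := by gcongr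
        _ = n.choose i * ‖A‖ ^ i * ‖B‖ ^ (n - i) * 2 ^ k *
            ((‖A x‖ ^ k * ‖iteratedFDeriv ℝ i f (A x)‖) * ‖iteratedFDeriv ℝ (n - i) g (B x)‖ +
              ‖iteratedFDeriv ℝ i f (A x)‖ *
                (‖B x‖ ^ k * ‖iteratedFDeriv ℝ (n - i) g (B x)‖)) := by ring
        _ ≤ _ := by gcongr

/-- For `A : E → E₁`, `B : E → E₂` with `‖x‖ ≤ ‖A x‖ + ‖B x‖` and a Schwartz function `g` on `E₂`,
the continuous linear map `f ↦ (x ↦ f (A x) * g (B x))` from `𝓢(E₁)` to `𝓢(E)`. -/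
def tensorCLM (A : E →L[ℝ] E₁) (B : E →L[ℝ] E₂) (hAB : ∀ x, ‖x‖ ≤ ‖A x‖ + ‖B x‖)
    (g : 𝓢(E₂, ℂ)) : 𝓢(E₁, ℂ) →L[ℂ] 𝓢(E, ℂ) :=
  SchwartzMap.mkCLM (fun f x => f (A x) * g (B x))
    (fun f₁ f₂ x => by simp [add_mul])
    (fun a f x => by simp [mul_assoc])
    (fun f => ((f.smooth ⊤).comp A.contDiff).mul ((g.smooth ⊤).comp B.contDiff)) <| by
  rintro ⟨k, n⟩
  refine ⟨Finset.Iic (k, n), ∑ i ∈ Finset.range (n + 1), n.choose i * ‖A‖ ^ i * ‖B‖ ^ (n - i) *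
    2 ^ k * (SchwartzMap.seminorm ℂ 0 (n - i) g + SchwartzMap.seminorm ℂ k (n - i) g),
    by positivity, fun f x => ?_⟩
  refine (norm_iteratedFDeriv_tensor_le A B f g hAB k n x).trans ?_
  rw [Finset.sum_mul]
  refine Finset.sum_le_sum fun i hi => ?_
  have hi' : i ≤ n := Nat.lt_succ_iff.mp (Finset.mem_range.mp hi)
  have key : ∀ m ≤ k, SchwartzMap.seminorm ℂ m i f ≤
      ((Finset.Iic (k, n)).sup (schwartzSeminormFamily ℂ E₁ ℂ)) f := fun m hm =>
    Seminorm.le_def.mp (Finset.le_sup (f := schwartzSeminormFamily ℂ E₁ ℂ)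
      (Finset.mem_Iic.mpr (show (m, i) ≤ (k, n) from ⟨hm, hi'⟩))) f
  have h1 := key k le_rfl
  have h0 := key 0 (Nat.zero_le _)
  set S := ((Finset.Iic (k, n)).sup (schwartzSeminormFamily ℂ E₁ ℂ)) f
  calc _ ≤ n.choose i * ‖A‖ ^ i * ‖B‖ ^ (n - i) * 2 ^ k *
        (S * SchwartzMap.seminorm ℂ 0 (n - i) g + S * SchwartzMap.seminorm ℂ k (n - i) g) := by
        gcongr
    _ = _ := by ring

@[simp] theorem tensorCLM_apply (A : E →L[ℝ] E₁) (B : E →L[ℝ] E₂)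
    (hAB : ∀ x, ‖x‖ ≤ ‖A x‖ + ‖B x‖) (g : 𝓢(E₂, ℂ)) (f : 𝓢(E₁, ℂ)) (x : E) :
    tensorCLM A B hAB g f x = f (A x) * g (B x) := rfl

end Tensor

/-! ### Homogeneous structure

The coordinates of `ℝ^N` are indexed by `ι`, and `blk : ι → κ` sends a coordinate to the index of
the factor `ℝ^{a_k}` to which it belongs (so `a_k` is the cardinality of the fibre over `k`); the
factors are ordered by the linear order of `κ`. The number `d j > 0` is the dilation exponent of the
coordinate `j`. -/

section Structure

variable {ι κ : Type*} [Fintype ι] [LinearOrder κ] [Fintype κ] (blk : ι → κ) (d : ι → ℝ)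

/-- The homogeneous norm `N_k(x_k) = max_{j in block k} |x_j| ^ (1 / d_j)`. -/
def blockNorm (k : κ) (x : ι → ℝ) : ℝ := ⨆ j : {j // blk j = k}, |x j| ^ (1 / d j)

/-- The homogeneous dimension `Q_k` of the factor `k`. -/
def blockDim (k : κ) : ℝ := ∑ j with blk j = k, d j

/-- For the derivative `∂_{s 0} ⋯ ∂_{s (m-1)}`, whose multi-index is `α_j = #{i | s i = j}`, this is
the homogeneous order `∑_{j in block k} α_j d_j` in the variables of the factor `k`. -/
def blockOrder {m : ℕ} (s : Fin m → ι) (k : κ) : ℝ := ∑ i with blk (s i) = k, d (s i)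

/-- The iterated partial derivative `∂_{s 0} ⋯ ∂_{s (m-1)} F` at `x`. -/
def partialDeriv [DecidableEq ι] {m : ℕ} (s : Fin m → ι) (F : (ι → ℝ) → ℂ) (x : ι → ℝ) : ℂ :=
  iteratedFDeriv ℝ m F x (fun i => Pi.single (s i) 1)

/-- The set `{x | x_k ≠ 0}` where `k` is the first factor. If there are no factors at all, then
`ℝ^N` is a point and this is the whole space. -/
def regularSet : Set (ι → ℝ) := {x | ∀ k, IsMin k → ∃ j, blk j = k ∧ x j ≠ 0}

/-- The product `∏_k (N_1(x_1) + ⋯ + N_k(x_k)) ^ (-Q_k - [[α_k]])`. -/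
def flagWeight {m : ℕ} (s : Fin m → ι) (x : ι → ℝ) : ℝ :=
  ∏ k : κ, (∑ l with l ≤ k, blockNorm blk d l x) ^ (-blockDim blk d k - blockOrder blk d s k)

/-- On test functions supported away from `{x_1 = 0}`, the distribution `K` is given by integration
against `F`, which is `C^∞` off `{x_1 = 0}`. -/
def IsGivenBy (K : 𝓢'(ι → ℝ, ℂ)) (F : (ι → ℝ) → ℂ) : Prop :=
  ContDiffOn ℝ ∞ F (regularSet blk) ∧
    ∀ φ : 𝓢(ι → ℝ, ℂ), HasCompactSupport φ → tsupport φ ⊆ regularSet blk →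
      K φ = ∫ x, F x * φ x

/-- The differential inequalities of a flag kernel, with constants `C s`. -/
def DiffIneqWith [DecidableEq ι] (K : 𝓢'(ι → ℝ, ℂ)) (C : (m : ℕ) → (Fin m → ι) → ℝ) : Prop :=
  ∃ F : (ι → ℝ) → ℂ, IsGivenBy blk K F ∧
    ∀ (m : ℕ) (s : Fin m → ι), ∀ x ∈ regularSet blk,
      ‖partialDeriv s F x‖ ≤ C m s * flagWeight blk d s x

/-- The norm `‖ψ‖_(p) = sup {|∂^α ψ(x)| : |α| ≤ p, x ∈ ℝ^N}` (for `ψ` smooth with compact support,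
this set is bounded). -/
def cNorm [DecidableEq ι] (p : ℕ) (ψ : (ι → ℝ) → ℂ) : ℝ :=
  sSup {t : ℝ | ∃ m ≤ p, ∃ (s : Fin m → ι) (x : ι → ℝ), t = ‖partialDeriv s ψ x‖}

/-- The dilation `x ↦ (R_k · x_k)_k`, with `(R_k · x_k)_j = R_k ^ (d j) * x_j`. -/
def dilation (R : κ → ℝ) (hR : ∀ k, 0 < R k) : (ι → ℝ) ≃L[ℝ] (ι → ℝ) :=
  ContinuousLinearEquiv.piCongrRight fun j =>
    ContinuousLinearEquiv.unitsEquivAut ℝ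
      (Units.mk0 (R (blk j) ^ d j) (Real.rpow_pos_of_pos (hR (blk j)) (d j)).ne')

end Structure

theorem dilation_apply {ι κ : Type*} (blk : ι → κ) (d : ι → ℝ) (R : κ → ℝ) (hR : ∀ k, 0 < R k) (x : ι → ℝ) (j : ι) :
    dilation blk d R hR x j = R (blk j) ^ d j * x j := by
  simp [dilation, mul_comm]

/-! ### Cancellation conditions

For a set `M` of factors and its complement `L`, the variable `x` splits as `x = (x_L, x_M)`. -/

section Cancellation

variable {ι κ : Type*} [Fintype ι] [LinearOrder κ] (blk : ι → κ) (d : ι → ℝ)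

/-- The coordinates of the factors in `M`. -/
abbrev CoordIn (M : Finset κ) : Type _ := {j : ι // blk j ∈ M}

/-- The coordinates of the factors in the complement `L` of `M`. -/
abbrev CoordOut (M : Finset κ) : Type _ := {j : ι // blk j ∉ M}

/-- The block map of the coordinates in `M`. -/
def blkIn (M : Finset κ) : CoordIn blk M → {k // k ∈ M} := fun j => ⟨blk j, j.2⟩

/-- The block map of the coordinates in `L`. -/
def blkOut (M : Finset κ) : CoordOut blk M → {k // k ∉ M} := fun j => ⟨blk j, j.2⟩

/-- The restriction `x ↦ x_M`. -/
def projIn (M : Finset κ) : (ι → ℝ) →L[ℝ] (CoordIn blk M → ℝ) :=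
  ContinuousLinearMap.pi fun j => ContinuousLinearMap.proj (j : ι)

/-- The restriction `x ↦ x_L`. -/
def projOut (M : Finset κ) : (ι → ℝ) →L[ℝ] (CoordOut blk M → ℝ) :=
  ContinuousLinearMap.pi fun j => ContinuousLinearMap.proj (j : ι)

theorem norm_le_projOut_add_projIn (M : Finset κ) (x : ι → ℝ) :
    ‖x‖ ≤ ‖projOut blk M x‖ + ‖projIn blk M x‖ := by
  refine (pi_norm_le_iff_of_nonneg (by positivity)).mpr fun j => ?_
  by_cases hj : blk j ∈ M
  · have h := norm_le_pi_norm (projIn blk M x) ⟨j, hj⟩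
    have h' : projIn blk M x ⟨j, hj⟩ = x j := rfl
    rw [h'] at h
    linarith [norm_nonneg (projOut blk M x)]
  · have h := norm_le_pi_norm (projOut blk M x) ⟨j, hj⟩
    have h' : projOut blk M x ⟨j, hj⟩ = x j := rfl
    rw [h'] at h
    linarith [norm_nonneg (projIn blk M x)]

/-- The dilate `ψ_R(x_M) = ψ((R_m · x_m)_{m ∈ M})`. -/
def dilate (M : Finset κ) (R : {k // k ∈ M} → ℝ) (hR : ∀ k, 0 < R k)
    (ψ : 𝓢(CoordIn blk M → ℝ, ℂ)) : 𝓢(CoordIn blk M → ℝ, ℂ) :=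
  SchwartzMap.compCLMOfContinuousLinearEquiv ℂ
    (dilation (blkIn blk M) (fun j => d j) R hR) ψ

/-- The distribution `K^#_{ψ,R}` in the variables `x_L`, given by
`⟨K^#_{ψ,R}, φ⟩ = ⟨K, ψ_R ⊗ φ⟩`. -/
def sharp (K : 𝓢'(ι → ℝ, ℂ)) (M : Finset κ) (R : {k // k ∈ M} → ℝ) (hR : ∀ k, 0 < R k)
    (ψ : 𝓢(CoordIn blk M → ℝ, ℂ)) : 𝓢'(CoordOut blk M → ℝ, ℂ) :=
  PointwiseConvergenceCLM.precomp ℂ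
    (tensorCLM (projOut blk M) (projIn blk M) (norm_le_projOut_add_projIn blk M)
      (dilate blk d M R hR ψ)) K

theorem sharp_apply (K : 𝓢'(ι → ℝ, ℂ)) (M : Finset κ) (R : {k // k ∈ M} → ℝ)
    (hR : ∀ k, 0 < R k) (ψ : 𝓢(CoordIn blk M → ℝ, ℂ)) (φ : 𝓢(CoordOut blk M → ℝ, ℂ)) :
    sharp blk d K M R hR ψ φ =
      K (tensorCLM (projOut blk M) (projIn blk M) (norm_le_projOut_add_projIn blk M)
        (dilate blk d M R hR ψ) φ) := rfl

variable [DecidableEq ι] [Fintype κ]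

/-- The cancellation conditions, for those scaling parameters `R` that are admissible: for every
splitting `L ∪ M` of the factors and every `ψ ∈ C_0^∞` in the variables `x_M`, the distribution
`K^#_{ψ,R}` satisfies the differential inequalities for the decomposition given by `L`. Its
constants do not depend on `R`, and depend on `ψ` only through its norms `‖ψ‖_(p)` (and the size
`ρ` of a ball that contains the support of `ψ`). -/
def Cancellation (admissible : (M : Finset κ) → ({k // k ∈ M} → ℝ) → Prop)
    (K : 𝓢'(ι → ℝ, ℂ)) : Prop :=
  ∀ (M : Finset κ) (ρ : ℝ),
    ∃ (C : (m : ℕ) → (Fin m → CoordOut blk M) → ℝ) (p : (m : ℕ) → (Fin m → CoordOut blk M) → ℕ),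
      ∀ ψ : 𝓢(CoordIn blk M → ℝ, ℂ), tsupport ψ ⊆ Metric.closedBall 0 ρ →
        ∀ (R : {k // k ∈ M} → ℝ) (hR : ∀ k, 0 < R k), admissible M R →
          DiffIneqWith (blkOut blk M) (fun j => d j) (sharp blk d K M R hR ψ)
            (fun m s => C m s * cNorm (p m s) ψ)

/-- The differential inequalities of a flag kernel. -/
def DiffIneq (K : 𝓢'(ι → ℝ, ℂ)) : Prop :=
  ∃ C : (m : ℕ) → (Fin m → ι) → ℝ, DiffIneqWith blk d K C

/-- `K` is a flag kernel: it satisfies the differential inequalities, and the cancellation conditions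
for all positive scaling parameters. -/
def IsFlagKernel (K : 𝓢'(ι → ℝ, ℂ)) : Prop :=
  DiffIneq blk d K ∧ Cancellation blk d (fun _ _ => True) K

/-- `K` satisfies the conditions of a flag kernel, except that the scaling parameters in the
cancellation conditions are restricted to `R_1 ≥ R_2 ≥ ⋯ ≥ R_s`. -/
def IsRestrictedFlagKernel (K : 𝓢'(ι → ℝ, ℂ)) : Prop :=
  DiffIneq blk d K ∧ Cancellation blk d (fun _ R => Antitone R) K

end Cancellation

end FlagKernel

end

set_option linter.unusedSectionVars false

namespace FlagKernel

noncomputable section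

/-! ### Homogeneous norms, the regular set and the flag weight. -/

section Weights

variable {ι κ : Type*} [Fintype ι] [LinearOrder κ] [Fintype κ] (blk : ι → κ) (d : ι → ℝ)

/-! Suppose first that the test function is a product ψ = ∏ f_c(x_c), and that R fails to decrease:
there are i < j in M with R_i < R_j. Then ψ_R reaches much farther in x_i than in x_j. Multiply the
functions of the coordinates in block i by a cutoff at the smaller scale 1/R_j. The truncated
function is a dilate with R_i replaced by R_j: its functions in block i are x ↦ f((R_i/R_j)^d x)
χ(x), whose derivatives are controlled because R_i/R_j ≤ 1.

The part cut away is supported where N_i(x_i) ≥ 1/R_j, while the coordinates of x_j are at most ρ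
R_j^{-d}. There x_i ≠ 0, so nothing singular remains in the variables i and j. Cancel only in M \
{i, j}, where the full condition is known by induction on M, and integrate the resulting function in
x_i and x_j. Since i precedes j, both of their factors in the flag weight are at most powers of N_i,
and their product is at most N_i^{-Q_i-Q_j}. Over this region the integral of that power is bounded
independently of R_j: the shell N_i ~ 2^n/R_j contributes a multiple of 2^{-nQ_j}. The remaining
factors are at most the flag weight of L. This is `diffIneqWith_sharp_sub_sharp`, which rests on
`exists_lintegral_shell_le` and `flagWeight_joinCoords_le`.

If i is exceeded by some later value and R_j is the largest later value, the replacement leaves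
fewer indices that are exceeded later (`exists_card_ascents_update_lt`). After boundedly many
replacements R is decreasing and the hypothesis applies. So there is a strong induction on M, with
an induction on the number of ascents inside it.

Products are used because the part cut away must factor into a function of (x_i, x_j) and one
dilated test function in the other variables of M. A general ψ is a sum of products: a Fourier
series on a large cube, multiplied by cutoffs, has coefficients that decay faster than any power,
with bounds in terms of the norms of ψ, whereas the norms of the modulated cutoffs grow polynomially
(`exists_product_expansion`). The estimates can then be summed
(`cancellation_of_productCancellation`). -/

theorem isOpen_regularSet : IsOpen (regularSet blk) := by
  have : regularSet blk = ⋂ k : κ, ⋂ _ : IsMin k, ⋃ j : ι, {x : ι → ℝ | blk j = k ∧ x j ≠ 0} := by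
    ext x; simp [regularSet]
  rw [this]
  refine isOpen_iInter_of_finite fun k => isOpen_iInter_of_finite fun _ =>
    isOpen_iUnion fun j => ?_
  by_cases hj : blk j = k
  · simpa [hj] using isOpen_ne_fun (continuous_apply j) continuous_const
  · simp [hj]

theorem blockNorm_nonneg (k : κ) (x : ι → ℝ) : 0 ≤ blockNorm blk d k x :=
  Real.iSup_nonneg fun _ => Real.rpow_nonneg (abs_nonneg _) _

theorem le_blockNorm {k : κ} {j : ι} (hj : blk j = k) (x : ι → ℝ) :
    |x j| ^ (1 / d j) ≤ blockNorm blk d k x :=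
  le_ciSup (f := fun j : {j // blk j = k} => |x j| ^ (1 / d j)) (Set.finite_range _).bddAbove
    ⟨j, hj⟩

theorem blockNorm_le {k : κ} {x : ι → ℝ} {t : ℝ} (ht : 0 ≤ t)
    (h : ∀ j, blk j = k → |x j| ^ (1 / d j) ≤ t) : blockNorm blk d k x ≤ t :=
  Real.iSup_le (fun j => h j j.2) ht

theorem blockNorm_pos {k : κ} {j : ι} (hj : blk j = k) {x : ι → ℝ} (hx : x j ≠ 0) :
    0 < blockNorm blk d k x :=
  (Real.rpow_pos_of_pos (abs_pos.mpr hx) _).trans_le (le_blockNorm blk d hj x)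

theorem exists_ne_zero_of_blockNorm_pos {k : κ} {x : ι → ℝ} (hd : ∀ j, 0 < d j)
    (hx : 0 < blockNorm blk d k x) : ∃ j, blk j = k ∧ x j ≠ 0 := by
  by_contra! h
  refine hx.not_ge (blockNorm_le blk d le_rfl fun j hj => ?_)
  rw [h j hj, abs_zero, Real.zero_rpow (by have := hd j; positivity)]

theorem continuous_blockNorm (hd : ∀ j, 0 < d j) (k : κ) : Continuous (blockNorm blk d k) := by
  rcases isEmpty_or_nonempty {j // blk j = k} with h | h
  · have : blockNorm blk d k = fun _ => 0 := by
      ext x; simp [blockNorm]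
    rw [this]; exact continuous_const
  · have : blockNorm blk d k = fun x => (Finset.univ : Finset {j // blk j = k}).sup'
        Finset.univ_nonempty fun j => |x j| ^ (1 / d j) := by
      ext x; simp only [blockNorm, Finset.sup'_univ_eq_ciSup]
    rw [this]
    refine Continuous.finset_sup'_apply _ fun j _ => ?_
    exact (continuous_apply (j : ι)).abs.rpow_const fun _ =>
      Or.inr (by have := hd j; positivity)

theorem exists_isMin_le (k : κ) : ∃ k₀ : κ, IsMin k₀ ∧ k₀ ≤ k := by
  have hne : (Finset.univ : Finset κ).Nonempty := ⟨k, Finset.mem_univ k⟩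
  exact ⟨Finset.univ.min' hne, fun b _ => Finset.min'_le _ _ (Finset.mem_univ b),
    Finset.min'_le _ _ (Finset.mem_univ k)⟩

theorem sum_blockNorm_pos {x : ι → ℝ} (hx : x ∈ regularSet blk) (k : κ) :
    0 < ∑ l with l ≤ k, blockNorm blk d l x := by
  obtain ⟨k₀, hmin, hle⟩ := exists_isMin_le k
  obtain ⟨j, hj, hxj⟩ := hx k₀ hmin
  exact Finset.sum_pos' (fun l _ => blockNorm_nonneg blk d l x)
    ⟨k₀, by simpa using hle, blockNorm_pos blk d hj hxj⟩

theorem flagWeight_nonneg {m : ℕ} (s : Fin m → ι) (x : ι → ℝ) : 0 ≤ flagWeight blk d s x :=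
  Finset.prod_nonneg fun _ _ => Real.rpow_nonneg
    (Finset.sum_nonneg fun _ _ => blockNorm_nonneg _ _ _ _) _

theorem continuousOn_flagWeight (hd : ∀ j, 0 < d j) {m : ℕ} (s : Fin m → ι) :
    ContinuousOn (flagWeight blk d s) (regularSet blk) := by
  unfold flagWeight
  refine continuousOn_finsetProd _ fun k _ => ?_
  refine ContinuousOn.rpow_const ?_ fun x hx => Or.inl (sum_blockNorm_pos blk d hx k).ne'
  exact continuousOn_finsetSum _ fun l _ => (continuous_blockNorm blk d hd l).continuousOn

end Weights

/-! ### Coordinate derivatives against full derivatives. -/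

section PartialDeriv

variable {ι : Type*} [Fintype ι] [DecidableEq ι]

/-- Expand every argument in the standard basis. This turns the coordinatewise differential
inequalities into bounds for the whole derivative, as domination under an integral requires. -/
theorem norm_multilinear_le_sum {m : ℕ} (f : ContinuousMultilinearMap ℝ (fun _ : Fin m => ι → ℝ) ℂ) :
    ‖f‖ ≤ ∑ s : Fin m → ι, ‖f fun i => Pi.single (s i) 1‖ := by
  refine f.opNorm_le_bound (by positivity) fun v => ?_
  have hv : v = fun i => ∑ j, v i j • (Pi.single j 1 : ι → ℝ) := by
    ext i j
    simp [Finset.sum_apply, Pi.single_apply]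
  have h1 : f v = ∑ s : Fin m → ι, (∏ i, v i (s i)) • f fun i => Pi.single (s i) 1 := by
    conv_lhs => rw [hv]
    rw [f.map_sum]
    exact Finset.sum_congr rfl fun s _ => f.map_smul_univ _ _
  rw [h1, Finset.sum_mul]
  refine (norm_sum_le _ _).trans (Finset.sum_le_sum fun s _ => ?_)
  rw [norm_smul, mul_comm, norm_prod]
  gcongr with i
  exact norm_le_pi_norm (v i) (s i)

theorem norm_partialDeriv_le {m : ℕ} (s : Fin m → ι) (F : (ι → ℝ) → ℂ) (x : ι → ℝ) :
    ‖partialDeriv s F x‖ ≤ ‖iteratedFDeriv ℝ m F x‖ := by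
  refine ((iteratedFDeriv ℝ m F x).le_opNorm _).trans_eq ?_
  rw [Finset.prod_eq_one, mul_one]
  intro i _
  rw [Pi.norm_single, norm_one]

theorem norm_iteratedFDeriv_le_sum {m : ℕ} (F : (ι → ℝ) → ℂ) (x : ι → ℝ) :
    ‖iteratedFDeriv ℝ m F x‖ ≤ ∑ s : Fin m → ι, ‖partialDeriv s F x‖ :=
  norm_multilinear_le_sum _

end PartialDeriv

/-! ### Differentiation under the integral sign to all orders. -/

section Parametric

variable {α E : Type*} [MeasurableSpace α] [NormedAddCommGroup E] [NormedSpace ℝ E]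

/-- The candidate `L` is tested on vectors only, so that a curried integral of multilinear maps can
be recognised as the derivative by evaluating it. -/
theorem hasFDerivAt_integral_of_eq_integral {F : Type*} [NormedAddCommGroup F] [NormedSpace ℝ F]
    {μ : Measure α} {g : α → E → F} {b : α → ℝ} {V : Set E} {x : E} (hV : V ∈ nhds x)
    (hmeas : ∀ᶠ y in nhds x, AEStronglyMeasurable (fun a => g a y) μ)
    (hint : Integrable (fun a => g a x) μ)
    (hmeas' : AEStronglyMeasurable (fun a => fderiv ℝ (g a) x) μ)
    (hbound : ∀ a, ∀ y ∈ V, ‖fderiv ℝ (g a) y‖ ≤ b a) (hb : Integrable b μ)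
    (hdiff : ∀ a, ∀ y ∈ V, DifferentiableAt ℝ (g a) y) {L : E →L[ℝ] F}
    (hL : ∀ v, L v = ∫ a, fderiv ℝ (g a) x v ∂μ) : HasFDerivAt (fun y => ∫ a, g a y ∂μ) L x := by
  have h := hasFDerivAt_integral_of_dominated_of_fderiv_le (𝕜 := ℝ) (bound := b)
    (F := fun y a => g a y) (F' := fun y a => fderiv ℝ (g a) y) hV hmeas hint hmeas'
    (Filter.Eventually.of_forall hbound) hb
    (Filter.Eventually.of_forall fun a y hy => (hdiff a y hy).hasFDerivAt)
  have hi : Integrable (fun a => fderiv ℝ (g a) x) μ :=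
    hb.mono' hmeas' (Filter.Eventually.of_forall fun a => hbound a x (mem_of_mem_nhds hV))
  have : L = ∫ a, fderiv ℝ (g a) x ∂μ := by
    ext v
    rw [hL, ContinuousLinearMap.integral_apply hi]
  rw [this]
  exact h

/-- Differentiation under the integral sign to all orders on an open set. -/
theorem hasFTaylorSeriesUpToOn_integral {μ : Measure α} {U : Set E} (hU : IsOpen U)
    {G : α → E → ℂ} (hG : ∀ a, ContDiffOn ℝ ∞ (G a) U)
    (hmeas : ∀ m, ∀ x ∈ U, AEStronglyMeasurable (fun a => iteratedFDeriv ℝ m (G a) x) μ)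
    (hbound : ∀ m, ∀ x ∈ U, ∃ b : α → ℝ, Integrable b μ ∧
      ∀ᶠ y in nhds x, ∀ a, ‖iteratedFDeriv ℝ m (G a) y‖ ≤ b a) :
    HasFTaylorSeriesUpToOn ∞ (fun x => ∫ a, G a x ∂μ)
      (fun x m => ∫ a, iteratedFDeriv ℝ m (G a) x ∂μ) U := by
  have hint : ∀ m, ∀ x ∈ U, Integrable (fun a => iteratedFDeriv ℝ m (G a) x) μ := by
    intro m x hx
    obtain ⟨b, hb, hbx⟩ := hbound m x hx
    exact hb.mono' (hmeas m x hx) (Filter.Eventually.of_forall hbx.self_of_nhds)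
  have hderiv : ∀ m, ∀ x ∈ U, HasFDerivAt (fun y => ∫ a, iteratedFDeriv ℝ m (G a) y ∂μ)
      (ContinuousMultilinearMap.curryLeft (∫ a, iteratedFDeriv ℝ (m + 1) (G a) x ∂μ)) x := by
    intro m x hx
    obtain ⟨b, hb, hbx⟩ := hbound (m + 1) x hx
    have hset : {y | y ∈ U ∧ ∀ a, ‖iteratedFDeriv ℝ (m + 1) (G a) y‖ ≤ b a} ∈ nhds x :=
      Filter.Eventually.and (hU.mem_nhds hx) hbx
    have hm' : AEStronglyMeasurable (fun a => fderiv ℝ (iteratedFDeriv ℝ m (G a)) x) μ := by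
      simp only [fderiv_iteratedFDeriv]
      exact (continuousMultilinearCurryLeftEquiv ℝ (fun _ : Fin (m + 1) => E)
        ℂ).continuous.comp_aestronglyMeasurable (hmeas (m + 1) x hx)
    refine hasFDerivAt_integral_of_eq_integral hset ?_ (hint m x hx) hm' ?_ hb ?_ fun v => ?_
    · filter_upwards [hU.mem_nhds hx] with y hy using hmeas m y hy
    · intro a y hy
      rw [norm_fderiv_iteratedFDeriv]
      exact hy.2 a
    · intro a y hy
      have h1 : ContDiffAt ℝ ∞ (G a) y := (hG a).contDiffAt (hU.mem_nhds hy.1)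
      exact h1.differentiableAt_iteratedFDeriv (m := m)
        (by exact_mod_cast WithTop.coe_lt_top m)
    · ext w
      rw [ContinuousMultilinearMap.integral_apply, ContinuousMultilinearMap.curryLeft_apply,
        ContinuousMultilinearMap.integral_apply (hint (m + 1) x hx)]
      · rfl
      · refine Integrable.mono' (hb.mul_const ‖v‖) ?_ (Filter.Eventually.of_forall fun a => ?_)
        · exact (ContinuousLinearMap.apply ℝ _ v).continuous.comp_aestronglyMeasurable hm'
        · refine (ContinuousLinearMap.le_opNorm _ v).trans ?_
          gcongr
          rw [norm_fderiv_iteratedFDeriv]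
          exact hbx.self_of_nhds a
  refine ⟨fun x hx => ?_, fun m _ x hx => (hderiv m x hx).hasFDerivWithinAt,
    fun m _ x hx => (hderiv m x hx).continuousAt.continuousWithinAt⟩
  have h := ContinuousLinearMap.integral_comp_comm
    (continuousMultilinearCurryFin0 ℝ E ℂ).toContinuousLinearEquiv.toContinuousLinearMap (hint 0 x hx)
  exact h.symm

theorem HasFTaylorSeriesUpToOn.iteratedFDeriv_eq {U : Set E} (hU : IsOpen U) {F : E → ℂ}
    {P : E → FormalMultilinearSeries ℝ E ℂ} (h : HasFTaylorSeriesUpToOn ∞ F P U) (m : ℕ) {x : E}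
    (hx : x ∈ U) : iteratedFDeriv ℝ m F x = P x m := by
  rw [← iteratedFDerivWithin_of_isOpen m hU hx]
  exact (h.eq_iteratedFDerivWithin_of_uniqueDiffOn (mod_cast le_top) hU.uniqueDiffOn hx).symm

end Parametric

/-! ### Stability of the differential inequalities under sums and superpositions. -/

section DiffIneqWith

variable {ι κ : Type*} [Fintype ι] [DecidableEq ι] [LinearOrder κ] [Fintype κ]
  {blk : ι → κ} {d : ι → ℝ}

theorem DiffIneqWith.mono {T : 𝓢'(ι → ℝ, ℂ)} {C C' : (m : ℕ) → (Fin m → ι) → ℝ}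
    (h : DiffIneqWith blk d T C) (hC : ∀ m s, C m s ≤ C' m s) : DiffIneqWith blk d T C' := by
  obtain ⟨F, hF, hb⟩ := h
  exact ⟨F, hF, fun m s x hx => (hb m s x hx).trans
    (mul_le_mul_of_nonneg_right (hC m s) (flagWeight_nonneg _ _ _ _))⟩

theorem integrable_mul_of_contDiffOn {U : Set (ι → ℝ)} (hU : IsOpen U)
    {F : (ι → ℝ) → ℂ} (hF : ContinuousOn F U) {φ : (ι → ℝ) → ℂ} (hφ : Continuous φ)
    (hc : HasCompactSupport φ) (hs : tsupport φ ⊆ U) : Continuous (fun x => F x * φ x) ∧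
      Integrable (fun x => F x * φ x) := by
  have h1 : Continuous (fun x => F x * φ x) := by
    refine continuous_of_tsupport fun x hx => ?_
    have hx' : x ∈ tsupport φ := closure_mono (Function.support_mul_subset_right F φ) hx
    exact ((hF.continuousAt (hU.mem_nhds (hs hx'))).mul hφ.continuousAt)
  exact ⟨h1, h1.integrable_of_hasCompactSupport hc.mul_left⟩

theorem DiffIneqWith.add {T T₁ T₂ : 𝓢'(ι → ℝ, ℂ)} {C₁ C₂ : (m : ℕ) → (Fin m → ι) → ℝ}
    (h₁ : DiffIneqWith blk d T₁ C₁) (h₂ : DiffIneqWith blk d T₂ C₂)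
    (hT : ∀ φ, T φ = T₁ φ + T₂ φ) :
    DiffIneqWith blk d T (fun m s => C₁ m s + C₂ m s) := by
  obtain ⟨F₁, ⟨hF₁, hK₁⟩, hb₁⟩ := h₁
  obtain ⟨F₂, ⟨hF₂, hK₂⟩, hb₂⟩ := h₂
  have hU := isOpen_regularSet blk
  refine ⟨F₁ + F₂, ⟨hF₁.add hF₂, fun φ hc hs => ?_⟩, fun m s x hx => ?_⟩
  · rw [hT, hK₁ φ hc hs, hK₂ φ hc hs, ← integral_add]
    · simp [add_mul]
    · exact (integrable_mul_of_contDiffOn hU hF₁.continuousOn φ.continuous hc hs).2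
    · exact (integrable_mul_of_contDiffOn hU hF₂.continuousOn φ.continuous hc hs).2
  · have e : partialDeriv s (F₁ + F₂) x = partialDeriv s F₁ x + partialDeriv s F₂ x := by
      unfold partialDeriv
      have hm : (m : WithTop ℕ∞) ≤ ∞ := mod_cast le_top
      rw [iteratedFDeriv_add_apply ((hF₁.contDiffAt (hU.mem_nhds hx)).of_le hm)
        ((hF₂.contDiffAt (hU.mem_nhds hx)).of_le hm)]
      rfl
    rw [e, add_mul]
    exact (norm_add_le _ _).trans (add_le_add (hb₁ m s x hx) (hb₂ m s x hx))

/-- A superposition of functions satisfying the differential inequalities. -/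
theorem diffIneqWith_integral (hd : ∀ j, 0 < d j) {α : Type*} [MeasurableSpace α] {μ : Measure α}
    [SFinite μ] {T : 𝓢'(ι → ℝ, ℂ)} {G : α → (ι → ℝ) → ℂ} {b : (m : ℕ) → (Fin m → ι) → α → ℝ}
    (hG : ∀ a, ContDiffOn ℝ ∞ (G a) (regularSet blk)) (hb : ∀ m s, Integrable (b m s) μ)
    (hbound : ∀ a m s, ∀ x ∈ regularSet blk,
      ‖partialDeriv s (G a) x‖ ≤ b m s a * flagWeight blk d s x)
    (hmeas : ∀ m, ∀ x ∈ regularSet blk,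
      AEStronglyMeasurable (fun a => iteratedFDeriv ℝ m (G a) x) μ)
    (hmeas' : ∀ φ : 𝓢(ι → ℝ, ℂ), HasCompactSupport φ → tsupport φ ⊆ regularSet blk →
      AEStronglyMeasurable (fun p : α × (ι → ℝ) => G p.1 p.2 * φ p.2) (μ.prod volume))
    (hT : ∀ φ : 𝓢(ι → ℝ, ℂ), HasCompactSupport φ → tsupport φ ⊆ regularSet blk →
      T φ = ∫ a, (∫ x, G a x * φ x) ∂μ) :
    DiffIneqWith blk d T (fun m s => ∫ a, b m s a ∂μ) := by
  have hU := isOpen_regularSet blk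
  have hser := hasFTaylorSeriesUpToOn_integral (μ := μ) hU hG hmeas (by
    intro m x hx
    -- By continuity the weight near `x` stays below its value at `x` plus 1, so one function of `a`
    -- dominates on a whole neighbourhood.
    refine ⟨fun a => ∑ s : Fin m → ι, |b m s a| * (flagWeight blk d s x + 1),
      integrable_finsetSum _ fun s _ => (hb m s).abs.mul_const _, ?_⟩
    have hev : ∀ᶠ y in nhds x, ∀ s : Fin m → ι, flagWeight blk d s y < flagWeight blk d s x + 1 := by
      refine Filter.eventually_all.mpr fun s => ?_
      exact ((continuousOn_flagWeight blk d hd s).continuousAt (hU.mem_nhds hx)).eventually_lt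
        continuousAt_const (lt_add_one _)
    filter_upwards [hev, hU.mem_nhds hx] with y hy hyU a
    refine (norm_iteratedFDeriv_le_sum _ _).trans (Finset.sum_le_sum fun s _ => ?_)
    refine (hbound a m s y hyU).trans ?_
    exact mul_le_mul (le_abs_self _) (hy s).le (flagWeight_nonneg _ _ _ _) (abs_nonneg _))
  refine ⟨fun x => ∫ a, G a x ∂μ, ⟨hser.contDiffOn, fun φ hc hs => ?_⟩, fun m s x hx => ?_⟩
  · rw [hT φ hc hs, integral_integral_swap]
    · simp only [integral_mul_const]
    -- The bound of order zero, from the empty tuple of derivatives, dominates the integrand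
    -- jointly; this justifies Fubini.
    · let s0 : Fin 0 → ι := Fin.elim0
      have hw : Continuous (fun x => ((flagWeight blk d s0 x : ℝ) : ℂ) * φ x) ∧
          Integrable (fun x => ((flagWeight blk d s0 x : ℝ) : ℂ) * φ x) :=
        integrable_mul_of_contDiffOn hU (Complex.continuous_ofReal.comp_continuousOn
          (continuousOn_flagWeight blk d hd s0)) φ.continuous hc hs
      refine ((hb 0 s0).mul_prod hw.2.norm).mono' (hmeas' φ hc hs)
        (Filter.Eventually.of_forall fun p => ?_)
      by_cases hp : p.2 ∈ regularSet blk
      · have h0 := hbound p.1 0 s0 p.2 hp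
        have h1 : partialDeriv s0 (G p.1) p.2 = G p.1 p.2 := by simp [partialDeriv]
        rw [h1] at h0
        simp only [Function.uncurry, norm_mul, Complex.norm_real, Real.norm_eq_abs,
          abs_of_nonneg (flagWeight_nonneg blk d s0 p.2)]
        rw [← mul_assoc]
        gcongr
      · have : φ p.2 = 0 := image_eq_zero_of_notMem_tsupport fun h => hp (hs h)
        simp [Function.uncurry, this]
  · have h1 : partialDeriv s (fun x => ∫ a, G a x ∂μ) x = ∫ a, partialDeriv s (G a) x ∂μ := by
      unfold partialDeriv
      rw [HasFTaylorSeriesUpToOn.iteratedFDeriv_eq hU hser m hx]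
      refine ContinuousMultilinearMap.integral_apply ?_ _
      refine Integrable.mono' (g := fun a => ∑ s : Fin m → ι, b m s a * flagWeight blk d s x)
        (integrable_finsetSum _ fun s _ => (hb m s).mul_const _) (hmeas m x hx) ?_
      exact Filter.Eventually.of_forall fun a => (norm_iteratedFDeriv_le_sum _ _).trans
        (Finset.sum_le_sum fun s _ => hbound a m s x hx)
    rw [h1, ← integral_mul_const]
    exact norm_integral_le_of_norm_le ((hb m s).mul_const _)
      (Filter.Eventually.of_forall fun a => hbound a m s x hx)

end DiffIneqWith

/-! ### Norms and cutoffs for functions of one variable. -/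

section Scalar

/-- The norm `∑_{l ≤ p} sup |f^(l)|` of a Schwartz function on the line. -/
def scalarNorm (p : ℕ) (f : 𝓢(ℝ, ℂ)) : ℝ :=
  ∑ l ∈ Finset.range (p + 1), SchwartzMap.seminorm ℂ 0 l f

theorem scalarNorm_nonneg (p : ℕ) (f : 𝓢(ℝ, ℂ)) : 0 ≤ scalarNorm p f :=
  Finset.sum_nonneg fun _ _ => apply_nonneg _ _

theorem scalarNorm_mono {p q : ℕ} (h : p ≤ q) (f : 𝓢(ℝ, ℂ)) : scalarNorm p f ≤ scalarNorm q f :=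
  Finset.sum_le_sum_of_subset_of_nonneg (Finset.range_mono (by omega)) fun _ _ _ => apply_nonneg _ _

theorem norm_iteratedFDeriv_le_scalarNorm {l p : ℕ} (h : l ≤ p) (f : 𝓢(ℝ, ℂ)) (x : ℝ) :
    ‖iteratedFDeriv ℝ l f x‖ ≤ scalarNorm p f := by
  have h1 := SchwartzMap.le_seminorm ℂ 0 l f x
  rw [pow_zero, one_mul] at h1
  exact h1.trans (Finset.single_le_sum (f := fun l => SchwartzMap.seminorm ℂ 0 l f)
    (fun _ _ => apply_nonneg _ _) (Finset.mem_range.mpr (by omega)))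

theorem norm_le_scalarNorm (p : ℕ) (f : 𝓢(ℝ, ℂ)) (x : ℝ) : ‖f x‖ ≤ scalarNorm p f := by
  simpa using norm_iteratedFDeriv_le_scalarNorm (Nat.zero_le p) f x

theorem scalarNorm_le {p : ℕ} {f : 𝓢(ℝ, ℂ)} {B : ℝ} (hB : 0 ≤ B)
    (h : ∀ l ≤ p, ∀ x, ‖iteratedFDeriv ℝ l f x‖ ≤ B) : scalarNorm p f ≤ (p + 1) * B := by
  have : ∀ l ∈ Finset.range (p + 1), SchwartzMap.seminorm ℂ 0 l f ≤ B := fun l hl =>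
    SchwartzMap.seminorm_le_bound ℂ 0 l f hB fun x => by
      simpa using h l (Nat.lt_succ_iff.mp (Finset.mem_range.mp hl)) x
  exact (Finset.sum_le_sum this).trans_eq (by simp)

/-- The chain rule produces powers of `t`, which are at most 1, and Leibniz's rule costs 2^p. The
bound is free of `t`; with t = (R_i/R_j)^d this keeps the constants independent of R. -/
theorem scalarNorm_mul_comp_le (p : ℕ) {f χ g : 𝓢(ℝ, ℂ)} {t : ℝ} (ht : |t| ≤ 1)
    (hg : ∀ x, g x = f (t * x) * χ x) :
    scalarNorm p g ≤ (p + 1) * 2 ^ p * scalarNorm p χ * scalarNorm p f := by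
  have hg' : (g : ℝ → ℂ) = fun x => f (t • x) * χ x := funext fun x => by simpa using hg x
  have hf : ContDiff ℝ ∞ fun x => f (t • x) :=
    (f.smooth ⊤).comp (contDiff_const_smul t)
  have hB : 0 ≤ 2 ^ p * scalarNorm p χ * scalarNorm p f := by
    have := scalarNorm_nonneg p f; have := scalarNorm_nonneg p χ; positivity
  refine (scalarNorm_le hB fun l hl x => ?_).trans_eq (by ring)
  rw [hg']
  refine (norm_iteratedFDeriv_mul_le hf (χ.smooth ⊤) x (n := l) (mod_cast le_top)).trans ?_
  calc ∑ i ∈ Finset.range (l + 1), (l.choose i : ℝ) * ‖iteratedFDeriv ℝ i (fun x => f (t • x)) x‖ *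
        ‖iteratedFDeriv ℝ (l - i) χ x‖
      ≤ ∑ i ∈ Finset.range (l + 1), (l.choose i : ℝ) * scalarNorm p f * scalarNorm p χ := by
        refine Finset.sum_le_sum fun i hi => ?_
        have hi' : i ≤ l := Nat.lt_succ_iff.mp (Finset.mem_range.mp hi)
        have h1 : ‖iteratedFDeriv ℝ i (fun x => f (t • x)) x‖ ≤ scalarNorm p f := by
          have hA : ‖t • ContinuousLinearMap.id ℝ ℝ‖ ≤ 1 :=
            ContinuousLinearMap.opNorm_le_bound _ zero_le_one fun y => by
              simpa using mul_le_mul_of_nonneg_right ht (abs_nonneg y)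
          calc _ ≤ _ := norm_iteratedFDeriv_comp_clm_le (t • ContinuousLinearMap.id ℝ ℝ) f i x
            _ ≤ 1 * scalarNorm p f := by
              refine mul_le_mul (pow_le_one₀ (norm_nonneg _) hA) ?_ (norm_nonneg _) zero_le_one
              exact norm_iteratedFDeriv_le_scalarNorm (hi'.trans hl) f _
            _ = _ := one_mul _
        have h2 := norm_iteratedFDeriv_le_scalarNorm (show l - i ≤ p by omega) χ x
        have := scalarNorm_nonneg p f
        gcongr
    _ = 2 ^ l * (scalarNorm p χ * scalarNorm p f) := by
        have h2 : (2 : ℝ) ^ l = ∑ i ∈ Finset.range (l + 1), (l.choose i : ℝ) := by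
          exact_mod_cast (Nat.sum_range_choose l).symm
        rw [h2, Finset.sum_mul]
        exact Finset.sum_congr rfl fun i _ => by ring
    _ ≤ 2 ^ p * scalarNorm p χ * scalarNorm p f := by
        have h1 := scalarNorm_nonneg p f
        have h2 := scalarNorm_nonneg p χ
        rw [mul_assoc]
        gcongr
        norm_num

/-- A smooth cutoff function on the line. -/
theorem exists_cutoff {δ : ℝ} (hδ : 0 < δ) : ∃ (χ : 𝓢(ℝ, ℂ)) (c : ℝ → ℝ), (∀ x, χ x = c x) ∧ (∀ x, 0 ≤ c x) ∧
    (∀ x, c x ≤ 1) ∧ (∀ x, |x| ≤ δ → c x = 1) ∧ tsupport χ ⊆ Metric.closedBall 0 (2 * δ) := by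
  let b : ContDiffBump (0 : ℝ) := ⟨δ, 2 * δ, hδ, by linarith⟩
  have hts : tsupport (fun x => (b x : ℂ)) ⊆ tsupport b :=
    closure_mono fun x hx => by
      simp only [Function.mem_support] at hx ⊢
      exact fun h => hx (by simp [h])
  have hc : HasCompactSupport (fun x => (b x : ℂ)) :=
    b.hasCompactSupport.of_isClosed_subset (isClosed_tsupport _) hts
  refine ⟨hc.toSchwartzMap (Complex.ofRealCLM.contDiff.comp b.contDiff), b, fun x => rfl,
    fun x => b.nonneg, fun x => b.le_one, fun x hx => b.one_of_mem_closedBall (by simpa using hx), ?_⟩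
  exact hts.trans b.tsupport_eq.subset

end Scalar

/-! ### Products of functions of one variable. -/

section Product

variable {J : Type*} [Fintype J]

theorem tsupport_prod_subset {f : J → 𝓢(ℝ, ℂ)} {ρ : ℝ} (hρ : 0 ≤ ρ)
    (hf : ∀ j, tsupport (f j) ⊆ Metric.closedBall 0 ρ) {ψ : (J → ℝ) → ℂ}
    (hψ : ∀ x, ψ x = ∏ j, f j (x j)) : tsupport ψ ⊆ Metric.closedBall 0 ρ := by
  refine closure_minimal (fun x hx => ?_) Metric.isClosed_closedBall
  rw [mem_closedBall_zero_iff]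
  refine (pi_norm_le_iff_of_nonneg hρ).mpr fun j => ?_
  rw [Function.mem_support, hψ, Finset.prod_ne_zero_iff] at hx
  exact mem_closedBall_zero_iff.mp (hf j (subset_tsupport _ (hx j (Finset.mem_univ j))))

theorem hasCompactSupport_of_subset_closedBall {ρ : ℝ} {ψ : (J → ℝ) → ℂ}
    (h : tsupport ψ ⊆ Metric.closedBall 0 ρ) : HasCompactSupport ψ :=
  (isCompact_closedBall _ _).of_isClosed_subset (isClosed_tsupport _) h

theorem contDiff_prod_scalar (f : J → 𝓢(ℝ, ℂ)) :
    ContDiff ℝ ∞ fun x : J → ℝ => ∏ j, f j (x j) :=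
  contDiff_prod fun j _ => ((f j).smooth ⊤).comp (contDiff_apply ℝ ℝ j)

theorem exists_schwartz_prod {f : J → 𝓢(ℝ, ℂ)} {ρ : ℝ} (hρ : 0 ≤ ρ)
    (hf : ∀ j, tsupport (f j) ⊆ Metric.closedBall 0 ρ) :
    ∃ ψ : 𝓢(J → ℝ, ℂ), ∀ x, ψ x = ∏ j, f j (x j) :=
  ⟨(hasCompactSupport_of_subset_closedBall
    (tsupport_prod_subset hρ hf fun _ => rfl)).toSchwartzMap (contDiff_prod_scalar f), fun _ => rfl⟩

variable [DecidableEq J]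

theorem norm_iteratedFDeriv_prod_scalar_le (f : J → 𝓢(ℝ, ℂ)) {l p : ℕ} (hl : l ≤ p) (x : J → ℝ) :
    ‖iteratedFDeriv ℝ l (fun x : J → ℝ => ∏ j, f j (x j)) x‖ ≤
      (∑ q ∈ (Finset.univ : Finset J).sym l, ((q : Multiset J).countPerms : ℝ)) *
        ∏ j, scalarNorm p (f j) := by
  have h0 : ∀ j ∈ (Finset.univ : Finset J), ContDiff ℝ ∞ fun x : J → ℝ => f j (x j) := fun j _ =>
    ((f j).smooth ⊤).comp (contDiff_apply ℝ ℝ j)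
  refine (norm_iteratedFDeriv_prod_le h0 (x := x) (n := l) (mod_cast le_top)).trans ?_
  rw [Finset.sum_mul]
  refine Finset.sum_le_sum fun q hq => ?_
  gcongr with j
  have hq' : (q : Multiset J).count j ≤ l := by
    have := Multiset.count_le_card j (q : Multiset J)
    rwa [Sym.card_coe] at this
  have h1 := norm_iteratedFDeriv_comp_clm_le (ContinuousLinearMap.proj j : (J → ℝ) →L[ℝ] ℝ) (f j)
    ((q : Multiset J).count j) x
  refine h1.trans ?_
  have h2 := norm_iteratedFDeriv_le_scalarNorm (hq'.trans hl) (f j) (x j)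
  have h3 : ‖(ContinuousLinearMap.proj j : (J → ℝ) →L[ℝ] ℝ)‖ ≤ 1 :=
    ContinuousLinearMap.opNorm_le_bound _ zero_le_one fun y => by
      simpa using norm_le_pi_norm y j
  calc _ ≤ 1 * scalarNorm p (f j) := by
        refine mul_le_mul (pow_le_one₀ (norm_nonneg _) h3) h2 (norm_nonneg _) zero_le_one
    _ = _ := one_mul _

/-- A constant for the estimate of `‖ψ‖_(p)` for a product function `ψ`. -/
def prodConst (J : Type*) [Fintype J] [DecidableEq J] (p : ℕ) : ℝ :=
  ∑ l ∈ Finset.range (p + 1),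
    ∑ q ∈ (Finset.univ : Finset J).sym l, ((q : Multiset J).countPerms : ℝ)

theorem prodConst_nonneg (p : ℕ) : 0 ≤ prodConst J p :=
  Finset.sum_nonneg fun _ _ => Finset.sum_nonneg fun _ _ => Nat.cast_nonneg _

theorem cNorm_prod_le (f : J → 𝓢(ℝ, ℂ)) (p : ℕ) {ψ : (J → ℝ) → ℂ}
    (hψ : ∀ x, ψ x = ∏ j, f j (x j)) : cNorm p ψ ≤ prodConst J p * ∏ j, scalarNorm p (f j) := by
  have h0 : 0 ≤ ∏ j, scalarNorm p (f j) := Finset.prod_nonneg fun j _ => scalarNorm_nonneg _ _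
  obtain rfl : ψ = fun x => ∏ j, f j (x j) := funext hψ
  refine Real.sSup_le ?_ (mul_nonneg (prodConst_nonneg p) h0)
  rintro t ⟨m, hm, s, x, rfl⟩
  refine (norm_partialDeriv_le s _ x).trans ((norm_iteratedFDeriv_prod_scalar_le f hm x).trans ?_)
  gcongr
  exact Finset.single_le_sum (f := fun l => ∑ q ∈ (Finset.univ : Finset J).sym l,
    ((q : Multiset J).countPerms : ℝ)) (fun _ _ => Finset.sum_nonneg fun _ _ => Nat.cast_nonneg _)
    (Finset.mem_range.mpr (by omega))

end Product

/-! ### Cancellation tested on products. -/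

section ProductCancellation

variable {ι κ : Type*} [Fintype ι] [LinearOrder κ] [DecidableEq ι] [Fintype κ]
  (blk : ι → κ) (d : ι → ℝ)

/-- The cancellation condition for products of functions of one variable. -/
def ProductCancellation (K : 𝓢'(ι → ℝ, ℂ)) (M : Finset κ)
    (admissible : ({k // k ∈ M} → ℝ) → Prop) : Prop :=
  ∀ ρ : ℝ, 2 ≤ ρ →
    ∃ (C : (m : ℕ) → (Fin m → CoordOut blk M) → ℝ) (p : (m : ℕ) → (Fin m → CoordOut blk M) → ℕ),
      (∀ m s, 0 ≤ C m s) ∧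
      ∀ f : CoordIn blk M → 𝓢(ℝ, ℂ), (∀ j, tsupport (f j) ⊆ Metric.closedBall 0 ρ) →
        ∀ (R : {k // k ∈ M} → ℝ) (hR : ∀ k, 0 < R k), admissible R →
          ∀ ψ : 𝓢(CoordIn blk M → ℝ, ℂ), (∀ x, ψ x = ∏ j, f j (x j)) →
            DiffIneqWith (blkOut blk M) (fun j => d j) (sharp blk d K M R hR ψ)
              (fun m s => C m s * ∏ j, scalarNorm (p m s) (f j))

theorem cNorm_nonneg {J : Type*} [Fintype J] [DecidableEq J] (p : ℕ) (ψ : (J → ℝ) → ℂ) :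
    0 ≤ cNorm p ψ :=
  Real.sSup_nonneg (by rintro t ⟨m, _, s, x, rfl⟩; exact norm_nonneg _)

theorem Cancellation.productCancellation {K : 𝓢'(ι → ℝ, ℂ)}
    {admissible : (M : Finset κ) → ({k // k ∈ M} → ℝ) → Prop}
    (hK : Cancellation blk d admissible K) (M : Finset κ) :
    ProductCancellation blk d K M (admissible M) := by
  intro ρ hρ
  obtain ⟨C, p, h⟩ := hK M ρ
  refine ⟨fun m s => |C m s| * prodConst (CoordIn blk M) (p m s), p,
    fun m s => mul_nonneg (abs_nonneg _) (prodConst_nonneg _), fun f hf R hR hadm ψ hψ => ?_⟩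
  refine (h ψ (tsupport_prod_subset (by linarith) hf hψ) R hR hadm).mono fun m s => ?_
  calc C m s * cNorm (p m s) ψ ≤ |C m s| * (prodConst (CoordIn blk M) (p m s) *
        ∏ j, scalarNorm (p m s) (f j)) :=
        mul_le_mul (le_abs_self _) (cNorm_prod_le f _ hψ) (cNorm_nonneg _ _) (abs_nonneg _)
    _ = _ := by ring

end ProductCancellation

/-! ### Splitting coordinates and Fubini. -/

section Combine

variable {X Y Z : Type*} (e : Y ⊕ X ≃ Z)

/-- The identification `ℝ^Y × ℝ^X → ℝ^Z` given by `Y ⊕ X ≃ Z`. -/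
def combine : ((Y → ℝ) × (X → ℝ)) →L[ℝ] (Z → ℝ) :=
  ContinuousLinearMap.pi fun z => Sum.elim
    (fun y => (ContinuousLinearMap.proj y).comp (ContinuousLinearMap.fst ℝ (Y → ℝ) (X → ℝ)))
    (fun x => (ContinuousLinearMap.proj x).comp (ContinuousLinearMap.snd ℝ (Y → ℝ) (X → ℝ)))
    (e.symm z)

@[simp] theorem combine_inl (p : (Y → ℝ) × (X → ℝ)) (y : Y) :
    combine e p (e (Sum.inl y)) = p.1 y := by
  simp [combine]

@[simp] theorem combine_inr (p : (Y → ℝ) × (X → ℝ)) (x : X) :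
    combine e p (e (Sum.inr x)) = p.2 x := by
  simp [combine]

theorem combine_eta (z : Z → ℝ) :
    combine e (fun y => z (e (Sum.inl y)), fun x => z (e (Sum.inr x))) = z := by
  ext i
  obtain ⟨j, rfl⟩ := e.surjective i
  rcases j with y | x <;> simp

theorem combine_single [DecidableEq X] [DecidableEq Z] (x : X) :
    combine e (0, Pi.single x 1) = Pi.single (e (Sum.inr x)) 1 := by
  ext i
  obtain ⟨j, rfl⟩ := e.surjective i
  rcases j with y | x' <;> simp [Pi.single_apply]

variable [Fintype X] [Fintype Y] [Fintype Z]

theorem measurePreserving_combine : MeasurePreserving (combine e) := by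
  have h1 := volume_measurePreserving_sumPiEquivProdPi_symm (fun _ : Y ⊕ X => ℝ)
  have h2 := volume_preserving_arrowCongr' e (MeasurableEquiv.refl ℝ) (MeasurePreserving.id volume)
  convert! h2.comp h1 using 1
  funext p
  funext i
  obtain ⟨j, rfl⟩ := e.surjective i
  rcases j with y | x
  · rw [combine_inl]
    simp [MeasurableEquiv.arrowCongr', Equiv.arrowCongr', Equiv.arrowCongr]
    rfl
  · rw [combine_inr]
    simp [MeasurableEquiv.arrowCongr', Equiv.arrowCongr', Equiv.arrowCongr]
    rfl

theorem measurableEmbedding_combine : MeasurableEmbedding (combine e) := by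
  have hinj : Function.Injective (combine e) := by
    intro p q h
    refine Prod.ext (funext fun y => ?_) (funext fun x => ?_)
    · simpa using congrFun h (e (Sum.inl y))
    · simpa using congrFun h (e (Sum.inr x))
  exact (combine e).continuous.measurableEmbedding hinj

theorem integral_combine {g : (Z → ℝ) → ℂ} (hg : Integrable g) :
    ∫ z, g z = ∫ y, ∫ x, g (combine e (y, x)) := by
  rw [← (measurePreserving_combine e).integral_comp (measurableEmbedding_combine e)]
  exact integral_prod _ ((measurePreserving_combine e).integrable_comp_of_integrable hg)

/-- For fixed `y` the slice map is a translate of a linear map, so only that linear part enters the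
derivatives. -/
theorem iteratedFDeriv_comp_combine {F : (Z → ℝ) → ℂ} {U : Set (Z → ℝ)} (hU : IsOpen U)
    (hF : ContDiffOn ℝ ∞ F U) {y : Y → ℝ} {x : X → ℝ} (h : combine e (y, x) ∈ U) (m : ℕ) :
    iteratedFDeriv ℝ m (fun x => F (combine e (y, x))) x =
      (iteratedFDeriv ℝ m F (combine e (y, x))).compContinuousLinearMap fun _ =>
        (combine e).comp (ContinuousLinearMap.inr ℝ (Y → ℝ) (X → ℝ)) := by
  set A := (combine e).comp (ContinuousLinearMap.inr ℝ (Y → ℝ) (X → ℝ))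
  set a := combine e (y, 0)
  have hA : ∀ x, combine e (y, x) = a + A x := fun x => by
    simp only [a, A, ContinuousLinearMap.comp_apply, ContinuousLinearMap.inr_apply, ← map_add,
      Prod.mk_add_mk, add_zero, zero_add]
  set V := (fun v => a + v) ⁻¹' U
  have hV : IsOpen V := hU.preimage (continuous_const.add continuous_id)
  have hFV : ContDiffOn ℝ ∞ (fun v => F (a + v)) V :=
    hF.comp (contDiff_const.add contDiff_id).contDiffOn fun v hv => hv
  have hAV : IsOpen (A ⁻¹' V) := hV.preimage A.continuous
  have hxV : A x ∈ V := by
    rw [hA] at h; exact h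
  have h1 := A.iteratedFDerivWithin_comp_right hFV hV.uniqueDiffOn hAV.uniqueDiffOn hxV (i := m)
    (mod_cast le_top)
  rw [iteratedFDerivWithin_of_isOpen m hAV hxV, iteratedFDerivWithin_of_isOpen m hV hxV,
    iteratedFDeriv_comp_add_left] at h1
  simp only [hA]
  exact h1

end Combine

/-! ### Integrating out a group of variables where the kernel is smooth. -/

section PartialIntegral

variable {X Y Z : Type*} [Fintype X] [Fintype Y] [Fintype Z] [DecidableEq X] [DecidableEq Z]
  {κX κZ : Type*} [LinearOrder κX] [Fintype κX] [LinearOrder κZ] [Fintype κZ]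
  {blkX : X → κX} {blkZ : Z → κZ} {dX : X → ℝ} {dZ : Z → ℝ}

/-- Integrating a kernel on `ℝ^Z = ℝ^Y × ℝ^X` against a test function on `ℝ^Y`, under the
assumption that the kernel is given by a function near the support. -/
theorem diffIneqWith_partial_integral (e : Y ⊕ X ≃ Z) (hdX : ∀ j, 0 < dX j)
    {S : 𝓢'(Z → ℝ, ℂ)} {C : (m : ℕ) → (Fin m → Z) → ℝ} (hS : DiffIneqWith blkZ dZ S C)
    (hC : ∀ m s, 0 ≤ C m s) {T : 𝓢'(X → ℝ, ℂ)} {h : (Y → ℝ) → ℂ} (hh : ContDiff ℝ ∞ h)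
    (hc : HasCompactSupport h) {wt : (Y → ℝ) → ℝ} (hwt : Integrable fun y => ‖h y‖ * wt y)
    (hreg : ∀ y ∈ tsupport h, ∀ x ∈ regularSet blkX, combine e (y, x) ∈ regularSet blkZ)
    (hw : ∀ y ∈ tsupport h, ∀ x ∈ regularSet blkX, ∀ (m : ℕ) (s : Fin m → X),
      flagWeight blkZ dZ (fun i => e (Sum.inr (s i))) (combine e (y, x)) ≤
        wt y * flagWeight blkX dX s x)
    (hT : ∀ (φ : 𝓢(X → ℝ, ℂ)) (φ' : 𝓢(Z → ℝ, ℂ)),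
      (∀ y x, φ' (combine e (y, x)) = h y * φ x) → T φ = S φ') :
    DiffIneqWith blkX dX T
      (fun m s => C m (fun i => e (Sum.inr (s i))) * ∫ y, ‖h y‖ * wt y) := by
  obtain ⟨F, ⟨hF, hSF⟩, hb⟩ := hS
  have hUX := isOpen_regularSet blkX
  have hUZ := isOpen_regularSet blkZ
  have hzero : ∀ y, y ∉ tsupport h → h y = 0 := fun y hy => image_eq_zero_of_notMem_tsupport hy
  have hcd : ∀ y ∈ tsupport h, ContDiffOn ℝ ∞ (fun x => F (combine e (y, x))) (regularSet blkX) :=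
    fun y hy => hF.comp ((combine e).contDiff.comp (contDiff_prodMk_right y)).contDiffOn
      fun x hx => hreg y hy x hx
  have hderiv : ∀ m, ∀ y, ∀ x ∈ regularSet blkX,
      iteratedFDeriv ℝ m (fun x => h y * F (combine e (y, x))) x =
        h y • (iteratedFDeriv ℝ m F (combine e (y, x))).compContinuousLinearMap fun _ =>
        (combine e).comp (ContinuousLinearMap.inr ℝ (Y → ℝ) (X → ℝ)) := by
    intro m y x hx
    by_cases hy : y ∈ tsupport h
    · rw [← iteratedFDeriv_comp_combine e hUZ hF (hreg y hy x hx)]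
      have h1 : ContDiffAt ℝ m (fun x => F (combine e (y, x))) x :=
        ((hcd y hy).contDiffAt (hUX.mem_nhds hx)).of_le (mod_cast le_top)
      exact iteratedFDeriv_const_smul_apply' (a := h y) h1
    · simp [hzero y hy]
  -- Nothing is known about `F` away from the regular set, but multiplication by `h` removes every
  -- point at which continuity of `g` could fail.
  have hcont : ∀ {V : Type _} [NormedAddCommGroup V] [NormedSpace ℂ V] (g : (Y → ℝ) → V),
      (∀ y ∈ tsupport h, ContinuousAt g y) → Continuous fun y => h y • g y := by
    intro V _ _ g hg
    refine continuous_of_tsupport fun y hy => ?_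
    exact hh.continuous.continuousAt.smul
      (hg y (closure_mono (Function.support_smul_subset_left h g) hy))
  have key := diffIneqWith_integral (blk := blkX) (d := dX) hdX (μ := (volume : Measure (Y → ℝ)))
    (T := T) (G := fun y x => h y * F (combine e (y, x)))
    (b := fun m s y => C m (fun i => e (Sum.inr (s i))) * (‖h y‖ * wt y)) ?_ ?_ ?_ ?_ ?_ ?_
  · simpa only [integral_const_mul] using key
  · intro y
    by_cases hy : y ∈ tsupport h
    · exact contDiffOn_const.mul (hcd y hy)
    · simp only [hzero y hy, zero_mul]; exact contDiffOn_const
  · exact fun m s => hwt.const_mul _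
  · intro y m s x hx
    unfold partialDeriv
    rw [hderiv m y x hx]
    by_cases hy : y ∈ tsupport h
    · simp only [smul_apply, smul_eq_mul, norm_mul,
        ContinuousMultilinearMap.compContinuousLinearMap_apply, ContinuousLinearMap.comp_apply,
        ContinuousLinearMap.inr_apply, combine_single]
      have h1 := hb m (fun i => e (Sum.inr (s i))) _ (hreg y hy x hx)
      have h2 := hw y hy x hx m s
      calc _ ≤ ‖h y‖ * (C m (fun i => e (Sum.inr (s i))) * (wt y * flagWeight blkX dX s x)) := by
            gcongr
            exact h1.trans (mul_le_mul_of_nonneg_left h2 (hC _ _))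
        _ = _ := by ring
    · simp [hzero y hy]
  · intro m x hx
    simp only [fun y => hderiv m y x hx]
    refine (hcont _ fun y hy => ?_).aestronglyMeasurable
    have h1 : ContinuousAt (iteratedFDeriv ℝ m F) (combine e (y, x)) := by
      have := (hF.contDiffAt (hUZ.mem_nhds (hreg y hy x hx)))
      exact (this.iteratedFDeriv_right (m := 0) (i := m)
        (by rw [zero_add]; exact mod_cast le_top)).continuousAt
    have h2 : ContinuousAt (fun y => iteratedFDeriv ℝ m F (combine e (y, x))) y :=
      h1.comp (f := fun y => combine e (y, x))
        ((combine e).continuous.comp (Continuous.prodMk_left x)).continuousAt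
    exact (ContinuousMultilinearMap.compContinuousLinearMapL (F := ℂ) fun _ : Fin m =>
      (combine e).comp (ContinuousLinearMap.inr ℝ (Y → ℝ) (X → ℝ))).continuous.continuousAt.comp h2
  · intro φ hφc hφs
    have h1 : ∀ p : (Y → ℝ) × (X → ℝ), h p.1 * F (combine e (p.1, p.2)) * φ p.2 =
        (h p.1 * φ p.2) * F (combine e p) := fun p => by ring
    simp only [h1]
    refine Continuous.aestronglyMeasurable (continuous_of_tsupport fun p hp => ?_)
    have hcl : IsClosed (tsupport h ×ˢ tsupport φ) :=
      (isClosed_tsupport _).prod (isClosed_tsupport _)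
    have hp' : p ∈ tsupport h ×ˢ tsupport φ := by
      refine closure_minimal (fun q hq => ?_) hcl hp
      have h2 := left_ne_zero_of_mul hq
      exact ⟨subset_tsupport _ (left_ne_zero_of_mul h2),
        subset_tsupport _ (right_ne_zero_of_mul h2)⟩
    have h3 : ContinuousAt F (combine e p) :=
      hF.continuousOn.continuousAt (hUZ.mem_nhds (hreg p.1 hp'.1 p.2 (hφs hp'.2)))
    exact ((hh.continuous.comp continuous_fst).mul
      (φ.continuous.comp continuous_snd)).continuousAt.mul
      (h3.comp (combine e).continuous.continuousAt)
  · intro φ hφc hφs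
    have hsm : ContDiff ℝ ∞ fun z : Z → ℝ =>
        h (fun y => z (e (Sum.inl y))) * φ (fun x => z (e (Sum.inr x))) := by
      refine (hh.comp ?_).mul ((φ.smooth ⊤).comp ?_)
      · exact contDiff_pi.mpr fun y => contDiff_apply ℝ ℝ _
      · exact contDiff_pi.mpr fun y => contDiff_apply ℝ ℝ _
    -- The test function h ⊗ φ on ℝ^Z. Its support lies in the regular set, so `S` acts on it by
    -- integration against `F`, and Fubini gives the iterated integral.
    set g : (Z → ℝ) → ℂ := fun z =>
        h (fun y => z (e (Sum.inl y))) * φ (fun x => z (e (Sum.inr x))) with hg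
    have hsub : Function.support g ⊆ combine e '' (tsupport h ×ˢ tsupport φ) := by
      intro z hz
      rw [Function.mem_support, hg] at hz
      exact ⟨_, ⟨subset_tsupport _ (left_ne_zero_of_mul hz),
        subset_tsupport _ (right_ne_zero_of_mul hz)⟩, combine_eta e z⟩
    have hcomp : IsCompact (combine e '' (tsupport h ×ˢ tsupport φ)) :=
      (hc.isCompact.prod hφc.isCompact).image (combine e).continuous
    have hts : tsupport g ⊆ combine e '' (tsupport h ×ˢ tsupport φ) :=
      closure_minimal hsub hcomp.isClosed
    have hgc : HasCompactSupport g := hcomp.of_isClosed_subset (isClosed_tsupport _) hts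
    have hgU : tsupport g ⊆ regularSet blkZ := by
      refine hts.trans ?_
      rintro _ ⟨⟨y, x⟩, ⟨hy, hx⟩, rfl⟩
      exact hreg y hy x (hφs hx)
    have hgv : ∀ y x, g (combine e (y, x)) = h y * φ x := fun y x => by simp [hg]
    obtain ⟨φ', hφ'⟩ : ∃ φ' : 𝓢(Z → ℝ, ℂ), (φ' : (Z → ℝ) → ℂ) = g :=
      ⟨hgc.toSchwartzMap hsm, rfl⟩
    rw [← hφ'] at hgc hgU hgv
    rw [hT φ φ' hgv, hSF φ' hgc hgU, integral_combine e
      (integrable_mul_of_contDiffOn hUZ hF.continuousOn φ'.continuous hgc hgU).2]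
    simp only [hgv]
    refine integral_congr_ae (Filter.Eventually.of_forall fun y =>
      integral_congr_ae (Filter.Eventually.of_forall fun x => ?_))
    ring

end PartialIntegral

/-! ### The uniform integral over a shell. -/

section ShellIntegral

variable {Y κY : Type*} [Fintype Y] [LinearOrder κY] [Fintype κY] (blk : Y → κY) (d : Y → ℝ)

/-- The set where the variable of the factor `k` has size at least `r`, and the other coordinates
have size at most a multiple of `r`. -/
def shell (k : κY) (ρ r : ℝ) : Set (Y → ℝ) :=
  {y | r ≤ blockNorm blk d k y ∧ ∀ j, blk j ≠ k → |y j| ≤ ρ * r ^ d j}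

theorem isClosed_shell (hd : ∀ j, 0 < d j) (k : κY) (ρ r : ℝ) : IsClosed (shell blk d k ρ r) := by
  have : shell blk d k ρ r = {y | r ≤ blockNorm blk d k y} ∩
      ⋂ j, ⋂ _ : blk j ≠ k, {y : Y → ℝ | |y j| ≤ ρ * r ^ d j} := by
    ext y; simp [shell]
  rw [this]
  refine (isClosed_le continuous_const (continuous_blockNorm blk d hd k)).inter ?_
  exact isClosed_iInter fun j => isClosed_iInter fun _ =>
    isClosed_le (continuous_apply j).abs continuous_const

/-- Cut dyadically: where 2^n r ≤ N_k < 2^{n+1} r the point lies in a box whose sides grow with n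
only in block `k`. Volume times the largest value of the integrand is at most A q^n, and all powers
of `r` cancel by homogeneity. A coordinate outside block `k` is what makes q < 1. -/
theorem exists_lintegral_shell_le (hd : ∀ j, 0 < d j) (k : κY) (hk : ∃ j, blk j ≠ k) {ρ : ℝ}
    (hρ : 0 ≤ ρ) : ∃ C : ENNReal, C ≠ ⊤ ∧ ∀ r : ℝ, 0 < r →
      ∫⁻ y in shell blk d k ρ r, ENNReal.ofReal (blockNorm blk d k y ^ (-∑ j, d j)) ≤ C := by
  classical
  -- The growth of the box compensates the decay of the integrand in block `k`. Each other
  -- coordinate leaves a factor 2^{-d_j} per dyadic step.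
  set q : ℝ := ∏ j, if blk j = k then 1 else (2 : ℝ) ^ (-d j) with hq
  set A : ℝ := ∏ j, if blk j = k then 2 * (2 : ℝ) ^ d j else 2 * ρ with hA
  have hq0 : 0 ≤ q := Finset.prod_nonneg fun j _ => by split_ifs <;> positivity
  have hq1 : q < 1 := by
    obtain ⟨j₀, hj₀⟩ := hk
    have h1 : ∀ j, (if blk j = k then 1 else (2 : ℝ) ^ (-d j)) ≤ 1 := fun j => by
      split_ifs
      · exact le_rfl
      · exact Real.rpow_le_one_of_one_le_of_nonpos one_le_two (by linarith [hd j])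
    rw [hq, ← Finset.mul_prod_erase _ _ (Finset.mem_univ j₀), if_neg hj₀]
    have h2 : (2 : ℝ) ^ (-d j₀) < 1 :=
      Real.rpow_lt_one_of_one_lt_of_neg one_lt_two (by linarith [hd j₀])
    have h3 : ∏ j ∈ Finset.univ.erase j₀, (if blk j = k then 1 else (2 : ℝ) ^ (-d j)) ≤ 1 :=
      Finset.prod_le_one (fun j _ => by split_ifs <;> positivity) fun j _ => h1 j
    calc _ ≤ (2 : ℝ) ^ (-d j₀) * 1 := by gcongr
      _ < 1 := by linarith
  refine ⟨∑' n : ℕ, ENNReal.ofReal A * ENNReal.ofReal q ^ n, ?_, fun r hr => ?_⟩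
  · rw [ENNReal.tsum_mul_left, ENNReal.tsum_geometric]
    refine ENNReal.mul_ne_top ENNReal.ofReal_ne_top (ENNReal.inv_ne_top.mpr ?_)
    exact (tsub_pos_of_lt (by simpa using hq1)).ne'
  set b : ℕ → Y → ℝ := fun n j => if blk j = k then (2 ^ (n + 1) * r) ^ d j else ρ * r ^ d j with hb
  set c : ℕ → ENNReal := fun n => ENNReal.ofReal ((2 ^ n * r) ^ (-∑ j, d j)) with hc
  have hpt : ∀ y ∈ shell blk d k ρ r, ENNReal.ofReal (blockNorm blk d k y ^ (-∑ j, d j)) ≤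
      ∑' n, (Icc (-b n) (b n)).indicator (fun _ => c n) y := by
    intro y hy
    obtain ⟨n, hn1, hn2⟩ := exists_nat_pow_near (x := blockNorm blk d k y / r) (y := 2)
      ((one_le_div hr).mpr hy.1) one_lt_two
    rw [le_div_iff₀ hr] at hn1
    rw [div_lt_iff₀ hr] at hn2
    have hmem : y ∈ Icc (-b n) (b n) := by
      have : ∀ j, |y j| ≤ b n j := by
        intro j
        by_cases hj : blk j = k
        · simp only [hb, if_pos hj]
          have h1 := (le_blockNorm blk d hj y).trans hn2.le
          have h2 := Real.rpow_le_rpow (by positivity) h1 (hd j).le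
          rwa [← Real.rpow_mul (abs_nonneg _), one_div_mul_cancel (hd j).ne', Real.rpow_one] at h2
        · simp only [hb, if_neg hj]
          exact hy.2 j hj
      exact ⟨fun j => (abs_le.mp (this j)).1, fun j => (abs_le.mp (this j)).2⟩
    refine le_trans ?_ (ENNReal.le_tsum n)
    rw [indicator_of_mem hmem]
    refine ENNReal.ofReal_le_ofReal (Real.rpow_le_rpow_of_nonpos (by positivity) hn1 ?_)
    exact neg_nonpos.mpr (Finset.sum_nonneg fun j _ => (hd j).le)
  calc ∫⁻ y in shell blk d k ρ r, ENNReal.ofReal (blockNorm blk d k y ^ (-∑ j, d j))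
      ≤ ∫⁻ y in shell blk d k ρ r, ∑' n, (Icc (-b n) (b n)).indicator (fun _ => c n) y :=
        setLIntegral_mono' (isClosed_shell blk d hd k ρ r).measurableSet hpt
    _ ≤ ∫⁻ y, ∑' n, (Icc (-b n) (b n)).indicator (fun _ => c n) y := setLIntegral_le_lintegral _ _
    _ = ∑' n, ∫⁻ y, (Icc (-b n) (b n)).indicator (fun _ => c n) y :=
        lintegral_tsum fun n => (measurable_const.indicator measurableSet_Icc).aemeasurable
    _ = ∑' n : ℕ, ENNReal.ofReal A * ENNReal.ofReal q ^ n := by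
        refine tsum_congr fun n => ?_
        rw [lintegral_indicator_const measurableSet_Icc, Real.volume_Icc_pi,
          ← ENNReal.ofReal_prod_of_nonneg, ← ENNReal.ofReal_mul (by positivity),
          ← ENNReal.ofReal_pow hq0, ← ENNReal.ofReal_mul]
        · congr 1
          have hpos : (0 : ℝ) < 2 ^ n * r := by positivity
          rw [← Finset.sum_neg_distrib, Real.rpow_sum_of_pos hpos, ← Finset.prod_mul_distrib, hA, hq,
            ← Finset.prod_pow, ← Finset.prod_mul_distrib]
          refine Finset.prod_congr rfl fun j _ => ?_
          have h2 : ((2 : ℝ) ^ n) ^ (-d j) * ((2 : ℝ) ^ n) ^ d j = 1 := by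
            rw [← Real.rpow_add (by positivity)]; simp
          have h3 : r ^ (-d j) * r ^ d j = 1 := by
            rw [← Real.rpow_add hr]; simp
          by_cases hj : blk j = k
          · simp only [hb, if_pos hj, one_pow, Pi.neg_apply, mul_one]
            rw [pow_succ, mul_assoc (2 ^ n) 2 r, mul_left_comm (2 ^ n) 2 r,
              Real.mul_rpow (by positivity) (by positivity),
              Real.mul_rpow (by positivity) (by positivity),
              Real.mul_rpow (by positivity) (by positivity)]
            linear_combination (2 * 2 ^ d j) * (((2 : ℝ) ^ n) ^ (-d j) * ((2 : ℝ) ^ n) ^ d j) * h3 +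
              (2 * 2 ^ d j) * h2
          · simp only [hb, if_neg hj, Pi.neg_apply]
            rw [Real.mul_rpow (by positivity) (by positivity), ← Real.rpow_natCast,
              ← Real.rpow_natCast, ← Real.rpow_mul zero_le_two, ← Real.rpow_mul zero_le_two,
              mul_comm (-d j) (n : ℝ)]
            linear_combination 2 * ρ * ((2 : ℝ) ^ ((n : ℝ) * -d j)) * h3
        · exact Finset.prod_nonneg fun j _ => by split_ifs <;> positivity
        · intro j _
          simp only [hb, Pi.neg_apply]
          split_ifs <;> · rw [sub_neg_eq_add]; positivity

theorem exists_integral_shell_le (hd : ∀ j, 0 < d j) (k : κY) (hk : ∃ j, blk j ≠ k) {ρ : ℝ}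
    (hρ : 0 ≤ ρ) : ∃ C : ℝ, 0 ≤ C ∧ ∀ r : ℝ, 0 < r → ∀ (g : (Y → ℝ) → ℝ) (B : ℝ), Measurable g →
      (∀ y, 0 ≤ g y) → (∀ y, g y ≤ B) → (∀ y, g y ≠ 0 → y ∈ shell blk d k ρ r) →
        Integrable (fun y => g y * blockNorm blk d k y ^ (-∑ j, d j)) ∧
        ∫ y, g y * blockNorm blk d k y ^ (-∑ j, d j) ≤ C * B := by
  obtain ⟨C, hC, h⟩ := exists_lintegral_shell_le blk d hd k hk hρ
  refine ⟨C.toReal, ENNReal.toReal_nonneg, fun r hr g B hgm hg0 hgB hgs => ?_⟩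
  have hB : 0 ≤ B := (hg0 0).trans (hgB 0)
  have hm := (isClosed_shell blk d hd k ρ r).measurableSet
  have hwm : Measurable fun y => blockNorm blk d k y ^ (-∑ j, d j) :=
    (continuous_blockNorm blk d hd k).measurable.pow_const _
  have hw0 : ∀ y, 0 ≤ blockNorm blk d k y ^ (-∑ j, d j) := fun y =>
    Real.rpow_nonneg (blockNorm_nonneg blk d k y) _
  have key : ∫⁻ y, ENNReal.ofReal (g y * blockNorm blk d k y ^ (-∑ j, d j)) ≤
      C * ENNReal.ofReal B := by
    calc _ ≤ ∫⁻ y, (shell blk d k ρ r).indicator (fun y => ENNReal.ofReal B *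
            ENNReal.ofReal (blockNorm blk d k y ^ (-∑ j, d j))) y := by
          refine lintegral_mono fun y => ?_
          by_cases hy : y ∈ shell blk d k ρ r
          · rw [indicator_of_mem hy, ← ENNReal.ofReal_mul hB]
            exact ENNReal.ofReal_le_ofReal (mul_le_mul_of_nonneg_right (hgB y) (hw0 y))
          · have : g y = 0 := by by_contra h0; exact hy (hgs y h0)
            simp [this]
      _ = ENNReal.ofReal B * ∫⁻ y in shell blk d k ρ r,
            ENNReal.ofReal (blockNorm blk d k y ^ (-∑ j, d j)) := by
          rw [lintegral_indicator hm, lintegral_const_mul _ hwm.ennreal_ofReal]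
      _ ≤ _ := by
          rw [mul_comm]; gcongr; exact h r hr
  have hnn : ∀ y, 0 ≤ g y * blockNorm blk d k y ^ (-∑ j, d j) := fun y => mul_nonneg (hg0 y) (hw0 y)
  have hfin : C * ENNReal.ofReal B ≠ ⊤ := ENNReal.mul_ne_top hC ENNReal.ofReal_ne_top
  refine ⟨⟨(hgm.mul hwm).aestronglyMeasurable, ?_⟩, ?_⟩
  · rw [hasFiniteIntegral_iff_ofReal (Filter.Eventually.of_forall hnn)]
    exact key.trans_lt hfin.lt_top
  · rw [integral_eq_lintegral_of_nonneg_ae (Filter.Eventually.of_forall hnn)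
      (hgm.mul hwm).aestronglyMeasurable]
    refine (ENNReal.toReal_mono hfin key).trans_eq ?_
    rw [ENNReal.toReal_mul, ENNReal.toReal_ofReal hB]

end ShellIntegral

/-! ### The partition of M into P and M \ P. -/

section Split

variable {α κ : Type*} [DecidableEq κ] (g : α → κ) {P M : Finset κ} (hP : P ⊆ M)

/-- The complement of `M \ P` is the union of `P` and the complement of `M`. -/
def splitOut : {a // g a ∈ P} ⊕ {a // g a ∉ M} ≃ {a // g a ∉ M \ P} where
  toFun := Sum.elim (fun a => ⟨a, fun h => (Finset.mem_sdiff.mp h).2 a.2⟩)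
    (fun a => ⟨a, fun h => a.2 (Finset.mem_sdiff.mp h).1⟩)
  invFun a := if h : g a ∈ P then Sum.inl ⟨a, h⟩ else
    Sum.inr ⟨a, fun h' => a.2 (Finset.mem_sdiff.mpr ⟨h', h⟩)⟩
  left_inv := by
    rintro (a | a)
    · simp [a.2]
    · have : g a ∉ P := fun h => a.2 (hP h)
      simp [this]
  right_inv a := by
    by_cases h : g a ∈ P <;> simp [h]

/-- The set `M` is the union of `P` and `M \ P`. -/
def splitIn : {a // g a ∈ P} ⊕ {a // g a ∈ M \ P} ≃ {a // g a ∈ M} where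
  toFun := Sum.elim (fun a => ⟨a, hP a.2⟩) (fun a => ⟨a, (Finset.mem_sdiff.mp a.2).1⟩)
  invFun a := if h : g a ∈ P then Sum.inl ⟨a, h⟩ else
    Sum.inr ⟨a, Finset.mem_sdiff.mpr ⟨a.2, h⟩⟩
  left_inv := by
    rintro (a | a)
    · simp [a.2]
    · have : g a ∉ P := (Finset.mem_sdiff.mp a.2).2
      simp [this]
  right_inv a := by
    by_cases h : g a ∈ P <;> simp [h]

theorem prod_splitIn [Fintype {a // g a ∈ P}] [Fintype {a // g a ∈ M \ P}]
    [Fintype {a // g a ∈ M}] {R : Type*} [CommMonoid R] (F : {a // g a ∈ M} → R) :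
    ∏ a, F a = (∏ a : {a // g a ∈ P}, F ⟨a, hP a.2⟩) *
      ∏ a : {a // g a ∈ M \ P}, F ⟨a, (Finset.mem_sdiff.mp a.2).1⟩ := by
  rw [← (splitIn g hP).prod_comp, Fintype.prod_sum_type]
  rfl

theorem prod_splitOut [Fintype {a // g a ∈ P}] [Fintype {a // g a ∉ M}]
    [Fintype {a // g a ∉ M \ P}] {R : Type*} [CommMonoid R] (F : {a // g a ∉ M \ P} → R) :
    ∏ a, F a = (∏ a : {a // g a ∈ P}, F (splitOut g hP (Sum.inl a))) *
      ∏ a : {a // g a ∉ M}, F (splitOut g hP (Sum.inr a)) := by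
  rw [← (splitOut g hP).prod_comp, Fintype.prod_sum_type]

end Split

/-! ### Comparing the weight on L ∪ P with that on L. -/

section WeightComparison

variable {ι κ : Type*} [Fintype ι] [DecidableEq ι] [LinearOrder κ] [Fintype κ]
  {blk : ι → κ} {d : ι → ℝ} {P M : Finset κ}

theorem blockDim_in (k : {k // k ∈ P}) :
    blockDim (blkIn blk P) (fun j => d j) k = blockDim blk d k := by
  refine Finset.sum_bij (fun j _ => (j : ι)) ?_ ?_ ?_ ?_
  · intro j hj
    simpa [blkIn, Subtype.ext_iff] using hj
  · exact fun _ _ _ _ h => Subtype.ext h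
  · intro j hj
    have hj' : blk j = k := by simpa using hj
    exact ⟨⟨j, hj' ▸ k.2⟩, by simpa [blkIn, Subtype.ext_iff] using hj', rfl⟩
  · exact fun _ _ => rfl

theorem blockDim_out (k : {k // k ∉ M}) :
    blockDim (blkOut blk M) (fun j => d j) k = blockDim blk d k := by
  refine Finset.sum_bij (fun j _ => (j : ι)) ?_ ?_ ?_ ?_
  · intro j hj
    simpa [blkOut, Subtype.ext_iff] using hj
  · exact fun _ _ _ _ h => Subtype.ext h
  · intro j hj
    have hj' : blk j = k := by simpa using hj
    exact ⟨⟨j, hj' ▸ k.2⟩, by simpa [blkOut, Subtype.ext_iff] using hj', rfl⟩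
  · exact fun _ _ => rfl

variable (hP : P ⊆ M)

/-- The coordinates outside `M \ P` are those in `P` and those outside `M`. -/
abbrev joinCoords (blk : ι → κ) (hP : P ⊆ M) :
    ((CoordIn blk P → ℝ) × (CoordOut blk M → ℝ)) →L[ℝ] (CoordOut blk (M \ P) → ℝ) :=
  combine (splitOut blk hP)

/-- The inclusion of the complement of `M` in the complement of `M \ P`. -/
abbrev outIncl (hP : P ⊆ M) (k : {k // k ∉ M}) : {k // k ∉ M \ P} := splitOut (fun k => k) hP (Sum.inr k)

/-- The inclusion of `P` in the complement of `M \ P`. -/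
abbrev inIncl (hP : P ⊆ M) (k : {k // k ∈ P}) : {k // k ∉ M \ P} := splitOut (fun k => k) hP (Sum.inl k)

theorem blockNorm_in_le_joinCoords (k : {k // k ∈ P}) (y : CoordIn blk P → ℝ)
    (x : CoordOut blk M → ℝ) : blockNorm (blkIn blk P) (fun j => d j) k y ≤
      blockNorm (blkOut blk (M \ P)) (fun j => d j) (inIncl hP k) (joinCoords blk hP (y, x)) := by
  refine blockNorm_le _ _ (blockNorm_nonneg _ _ _ _) fun j hj => ?_
  have hj' : blkOut blk (M \ P) (splitOut blk hP (Sum.inl j)) = inIncl hP k :=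
    by
    have h0 := Subtype.ext_iff.mp hj
    exact Subtype.ext h0
  have h := le_blockNorm (blkOut blk (M \ P)) (fun j => d j) hj' (joinCoords blk hP (y, x))
  rwa [joinCoords, combine_inl] at h

theorem blockNorm_out_le_joinCoords (k : {k // k ∉ M}) (y : CoordIn blk P → ℝ)
    (x : CoordOut blk M → ℝ) : blockNorm (blkOut blk M) (fun j => d j) k x ≤
      blockNorm (blkOut blk (M \ P)) (fun j => d j) (outIncl hP k) (joinCoords blk hP (y, x)) := by
  refine blockNorm_le _ _ (blockNorm_nonneg _ _ _ _) fun j hj => ?_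
  have hj' : blkOut blk (M \ P) (splitOut blk hP (Sum.inr j)) = outIncl hP k :=
    by
    have h0 := Subtype.ext_iff.mp hj
    exact Subtype.ext h0
  have h := le_blockNorm (blkOut blk (M \ P)) (fun j => d j) hj' (joinCoords blk hP (y, x))
  rwa [joinCoords, combine_inr] at h

variable {k₀ : {k // k ∈ P}} {y : CoordIn blk P → ℝ} {x : CoordOut blk M → ℝ}

/-- The first factor of L ∪ P is either `k₀`, where `y` does not vanish, or the first factor of L,
where `x` does not vanish. -/
theorem joinCoords_mem_regularSet (hd : ∀ j, 0 < d j) (hmin : ∀ k, k₀ ≤ k)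
    (hy : 0 < blockNorm (blkIn blk P) (fun j => d j) k₀ y) (hx : x ∈ regularSet (blkOut blk M)) :
    joinCoords blk hP (y, x) ∈ regularSet (blkOut blk (M \ P)) := by
  intro k hk
  by_cases hkP : (k : κ) ∈ P
  · have h0 : inIncl hP k₀ = k :=
      hk.eq_of_le (Subtype.coe_le_coe.mp (hmin ⟨k, hkP⟩))
    have h1 := hy.trans_le (blockNorm_in_le_joinCoords (d := d) hP k₀ y x)
    rw [h0] at h1
    exact exists_ne_zero_of_blockNorm_pos _ _ (fun j => hd j) h1
  · have hkM : (k : κ) ∉ M := fun h => k.2 (Finset.mem_sdiff.mpr ⟨h, hkP⟩)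
    obtain ⟨j, hj, hxj⟩ := hx ⟨k, hkM⟩ fun b hb => hk (b := outIncl hP b) hb
    have h0 := Subtype.ext_iff.mp hj
    refine ⟨splitOut blk hP (Sum.inr j), Subtype.ext h0, ?_⟩
    rwa [joinCoords, combine_inr]

/-- All exponents are nonpositive, so terms may be dropped from the sums being raised to them. For a
factor in P, keep only the norm of `k₀`, which occurs because `k₀` is the first factor of P; no
derivative falls there, so only -Q_k remains. For a factor in L, drop the norms of the factors in P.
-/
theorem flagWeight_joinCoords_le (hd : ∀ j, 0 < d j) (hmin : ∀ k, k₀ ≤ k)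
    (hy : 0 < blockNorm (blkIn blk P) (fun j => d j) k₀ y) (hx : x ∈ regularSet (blkOut blk M))
    {m : ℕ} (s : Fin m → CoordOut blk M) :
    flagWeight (blkOut blk (M \ P)) (fun j => d j) (fun i => splitOut blk hP (Sum.inr (s i)))
        (joinCoords blk hP (y, x)) ≤
      blockNorm (blkIn blk P) (fun j => d j) k₀ y ^ (-∑ j : CoordIn blk P, d j) *
        flagWeight (blkOut blk M) (fun j => d j) s x := by
  set ν := blockNorm (blkIn blk P) (fun j => d j) k₀ y
  have hQ : ∀ k, 0 ≤ blockDim blk d k := fun k => Finset.sum_nonneg fun j _ => (hd j).le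
  have hprod : ν ^ (-∑ j : CoordIn blk P, d j) = ∏ k : {k // k ∈ P}, ν ^ (-blockDim blk d k) := by
    rw [← Real.rpow_sum_of_pos hy, Finset.sum_neg_distrib]
    simp only [← blockDim_in]
    unfold blockDim
    rw [Finset.sum_fiberwise]
  have hsum0 : ∀ k : {k // k ∉ M \ P}, 0 ≤ ∑ l with l ≤ k,
      blockNorm (blkOut blk (M \ P)) (fun j => d j) l (joinCoords blk hP (y, x)) := fun k =>
    Finset.sum_nonneg fun l _ => blockNorm_nonneg _ _ _ _
  rw [hprod]
  unfold flagWeight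
  have hsplit := prod_splitOut (fun k : κ => k) hP fun k : {k // k ∉ M \ P} =>
    (∑ l with l ≤ k, blockNorm (blkOut blk (M \ P)) (fun j => d j) l (joinCoords blk hP (y, x))) ^
      (-blockDim (blkOut blk (M \ P)) (fun j => d j) k - blockOrder (blkOut blk (M \ P))
        (fun j => d j) (fun i => splitOut blk hP (Sum.inr (s i))) k)
  refine hsplit.trans_le ?_
  refine mul_le_mul (Finset.prod_le_prod (fun k _ => Real.rpow_nonneg (hsum0 _) _) fun k _ => ?_)
    (Finset.prod_le_prod (fun k _ => Real.rpow_nonneg (hsum0 _) _) fun k _ => ?_)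
    (Finset.prod_nonneg fun k _ => Real.rpow_nonneg (hsum0 _) _)
    (Finset.prod_nonneg fun k _ => Real.rpow_nonneg (blockNorm_nonneg _ _ _ _) _)
  · have hord : blockOrder (blkOut blk (M \ P)) (fun j => d j)
        (fun i => splitOut blk hP (Sum.inr (s i))) (inIncl hP k) = 0 := by
      refine Finset.sum_eq_zero fun i hi => ?_
      have h1 : blk (s i) = k := congrArg Subtype.val (Finset.mem_filter.mp hi).2
      exact absurd (h1 ▸ hP k.2) (s i).2
    change _ ^ (-blockDim _ _ (inIncl hP k) - blockOrder _ _ _ (inIncl hP k)) ≤ _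
    rw [hord, blockDim_out, sub_zero]
    refine Real.rpow_le_rpow_of_nonpos hy ?_ (neg_nonpos.mpr (hQ _))
    refine (blockNorm_in_le_joinCoords hP k₀ y x).trans ?_
    exact Finset.single_le_sum (f := fun l => blockNorm (blkOut blk (M \ P)) (fun j => d j) l
      (joinCoords blk hP (y, x))) (fun l _ => blockNorm_nonneg _ _ _ _)
      (Finset.mem_filter.mpr ⟨Finset.mem_univ _, Subtype.coe_le_coe.mp (hmin k)⟩)
  · have hord : blockOrder (blkOut blk (M \ P)) (fun j => d j)
        (fun i => splitOut blk hP (Sum.inr (s i))) (outIncl hP k) =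
        blockOrder (blkOut blk M) (fun j => d j) s k := by
      unfold blockOrder
      refine Finset.sum_congr (Finset.filter_congr fun i _ => ?_) fun i _ => rfl
      rw [Subtype.ext_iff, Subtype.ext_iff]
      rfl
    have hord0 : 0 ≤ blockOrder (blkOut blk M) (fun j => d j) s k :=
      Finset.sum_nonneg fun i _ => (hd _).le
    change _ ^ (-blockDim _ _ (outIncl hP k) - blockOrder _ _ _ (outIncl hP k)) ≤ _
    rw [hord, blockDim_out, blockDim_out]
    refine Real.rpow_le_rpow_of_nonpos (sum_blockNorm_pos _ _ hx k) ?_ (by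
      have := hQ k
      have h2 : blockDim blk d (outIncl hP k : κ) = blockDim blk d k := rfl
      linarith)
    calc ∑ l with l ≤ k, blockNorm (blkOut blk M) (fun j => d j) l x
        ≤ ∑ l with l ≤ k, blockNorm (blkOut blk (M \ P)) (fun j => d j) (outIncl hP l)
          (joinCoords blk hP (y, x)) :=
          Finset.sum_le_sum fun l _ => blockNorm_out_le_joinCoords hP l y x
      _ = ∑ l ∈ (Finset.univ.filter (· ≤ k)).image (outIncl hP), blockNorm (blkOut blk (M \ P))
          (fun j => d j) l (joinCoords blk hP (y, x)) := by
          rw [Finset.sum_image]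
          intro a _ b _ h
          have h0 := Subtype.ext_iff.mp h
          exact Subtype.ext h0
      _ ≤ _ := by
          refine Finset.sum_le_sum_of_subset_of_nonneg ?_ fun l _ _ => blockNorm_nonneg _ _ _ _
          intro l hl
          obtain ⟨l', hl', rfl⟩ := Finset.mem_image.mp hl
          exact Finset.mem_filter.mpr ⟨Finset.mem_univ _, (Finset.mem_filter.mp hl').2⟩

end WeightComparison

/-! ### The part cut away when one dilation parameter is enlarged. -/

section Remainder

variable {ι κ : Type*} [Fintype ι] [DecidableEq ι] [LinearOrder κ] [Fintype κ]
  {blk : ι → κ} {d : ι → ℝ} {M : Finset κ}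

theorem dilate_apply (R : {k // k ∈ M} → ℝ) (hR : ∀ k, 0 < R k) (ψ : 𝓢(CoordIn blk M → ℝ, ℂ))
    (x : CoordIn blk M → ℝ) :
    dilate blk d M R hR ψ x = ψ fun c => R (blkIn blk M c) ^ d c * x c := by
  have h : dilation (blkIn blk M) (fun j => d j) R hR x = fun c => R (blkIn blk M c) ^ d c * x c :=
    funext fun c => dilation_apply _ _ _ _ _ _
  rw [← h]
  rfl

variable {P : Finset κ} (hP : P ⊆ M)

/-- The factor in the variables of `P` of the difference of two product functions. -/
def shellFactor (f : CoordIn blk M → 𝓢(ℝ, ℂ)) (χ : 𝓢(ℝ, ℂ)) (R : {k // k ∈ M} → ℝ) (k₀ : κ)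
    (t : ℝ) (d : ι → ℝ) (y : CoordIn blk P → ℝ) : ℂ :=
  (∏ c : CoordIn blk P, f ⟨c, hP c.2⟩ (R ⟨blk c, hP c.2⟩ ^ d c * y c)) *
    (1 - ∏ c : CoordIn blk P, if blk c = k₀ then χ (t ^ d c * y c) else 1)

theorem contDiff_shellFactor (f : CoordIn blk M → 𝓢(ℝ, ℂ)) (χ : 𝓢(ℝ, ℂ)) (R : {k // k ∈ M} → ℝ)
    (k₀ : κ) (t : ℝ) : ContDiff ℝ ∞ (shellFactor hP f χ R k₀ t d) := by
  have h1 : ∀ (g : 𝓢(ℝ, ℂ)) (a : ℝ) (c : CoordIn blk P),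
      ContDiff ℝ ∞ fun y : CoordIn blk P → ℝ => g (a * y c) := fun g a c =>
    (g.smooth ⊤).comp (contDiff_const.mul (contDiff_apply ℝ ℝ c))
  refine (contDiff_prod fun c _ => h1 _ _ c).mul (contDiff_const.sub (contDiff_prod fun c _ => ?_))
  split_ifs
  · exact h1 _ _ c
  · exact contDiff_const

/-- One minus a product of numbers in [0, 1] is again in [0, 1]. The order `p` is free, so that it
can later match the order required in the other variables. -/
theorem norm_shellFactor_le (f : CoordIn blk M → 𝓢(ℝ, ℂ)) {χ : 𝓢(ℝ, ℂ)} {χ' : ℝ → ℝ}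
    (hχ : ∀ x, χ x = χ' x) (hχ0 : ∀ x, 0 ≤ χ' x) (hχ1 : ∀ x, χ' x ≤ 1) (R : {k // k ∈ M} → ℝ)
    (k₀ : κ) (t : ℝ) (p : ℕ) (y : CoordIn blk P → ℝ) :
    ‖shellFactor hP f χ R k₀ t d y‖ ≤ ∏ c : CoordIn blk P, scalarNorm p (f ⟨c, hP c.2⟩) := by
  have h0 : ∀ c : CoordIn blk P, 0 ≤ (if blk c = k₀ then χ' (t ^ d c * y c) else 1) := fun c => by
    split_ifs
    · exact hχ0 _
    · exact zero_le_one
  have h1 : ∀ c : CoordIn blk P, (if blk c = k₀ then χ' (t ^ d c * y c) else 1) ≤ 1 := fun c => by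
    split_ifs
    · exact hχ1 _
    · exact le_rfl
  have h2 : ‖(1 : ℂ) - ∏ c : CoordIn blk P, if blk c = k₀ then χ (t ^ d c * y c) else 1‖ ≤ 1 := by
    have : (1 : ℂ) - ∏ c : CoordIn blk P, (if blk c = k₀ then χ (t ^ d c * y c) else 1) =
        ((1 - ∏ c : CoordIn blk P, (if blk c = k₀ then χ' (t ^ d c * y c) else 1) : ℝ) : ℂ) := by
      push_cast
      congr 1
      exact Finset.prod_congr rfl fun c _ => by split_ifs <;> simp [hχ]
    rw [this, Complex.norm_real, Real.norm_eq_abs, abs_le]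
    have h3 := Finset.prod_le_one (s := Finset.univ) (fun c _ => h0 c) fun c _ => h1 c
    have h4 := Finset.prod_nonneg (s := Finset.univ) fun c _ => h0 c
    constructor <;> linarith
  unfold shellFactor
  rw [norm_mul, norm_prod]
  have h5 : ∏ c : CoordIn blk P, ‖f ⟨c, hP c.2⟩ (R ⟨blk c, hP c.2⟩ ^ d c * y c)‖ ≤
      ∏ c : CoordIn blk P, scalarNorm p (f ⟨c, hP c.2⟩) :=
    Finset.prod_le_prod (fun c _ => norm_nonneg _) fun c _ => norm_le_scalarNorm _ _ _
  calc _ ≤ (∏ c : CoordIn blk P, scalarNorm p (f ⟨c, hP c.2⟩)) * 1 :=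
        mul_le_mul h5 h2 (norm_nonneg _) (Finset.prod_nonneg fun c _ => scalarNorm_nonneg _ _)
    _ = _ := mul_one _

theorem abs_le_of_shellFactor_ne_zero {f : CoordIn blk M → 𝓢(ℝ, ℂ)} {χ : 𝓢(ℝ, ℂ)}
    {R : {k // k ∈ M} → ℝ} (hR : ∀ k, 0 < R k) {k₀ : κ} {t ρ : ℝ}
    (hf : ∀ j, tsupport (f j) ⊆ Metric.closedBall 0 ρ) {y : CoordIn blk P → ℝ}
    (hy : shellFactor hP f χ R k₀ t d y ≠ 0) (c : CoordIn blk P) :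
    |y c| ≤ ρ * (R ⟨blk c, hP c.2⟩)⁻¹ ^ d c := by
  have h1 := Finset.prod_ne_zero_iff.mp (left_ne_zero_of_mul hy) c (Finset.mem_univ c)
  have h2 := mem_closedBall_zero_iff.mp (hf _ (subset_tsupport _ h1))
  have hpos := Real.rpow_pos_of_pos (hR ⟨blk c, hP c.2⟩) (d c)
  rw [Real.norm_eq_abs, abs_mul, abs_of_pos hpos] at h2
  rw [Real.inv_rpow (hR _).le, ← div_eq_mul_inv, le_div_iff₀ hpos, mul_comm]
  exact h2

theorem hasCompactSupport_shellFactor {f : CoordIn blk M → 𝓢(ℝ, ℂ)} {χ : 𝓢(ℝ, ℂ)}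
    {R : {k // k ∈ M} → ℝ} (hR : ∀ k, 0 < R k) {k₀ : κ} {t ρ : ℝ} (hρ : 0 ≤ ρ)
    (hf : ∀ j, tsupport (f j) ⊆ Metric.closedBall 0 ρ) :
    HasCompactSupport (shellFactor hP f χ R k₀ t d) := by
  have h0 : ∀ c : CoordIn blk P, 0 ≤ ρ * (R ⟨blk c, hP c.2⟩)⁻¹ ^ d c := fun c =>
    mul_nonneg hρ (Real.rpow_nonneg (inv_nonneg.mpr (hR _).le) _)
  refine hasCompactSupport_of_subset_closedBall
    (ρ := ∑ c : CoordIn blk P, ρ * (R ⟨blk c, hP c.2⟩)⁻¹ ^ d c)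
    (closure_minimal (fun y hy => ?_) Metric.isClosed_closedBall)
  rw [mem_closedBall_zero_iff]
  refine (pi_norm_le_iff_of_nonneg (Finset.sum_nonneg fun c _ => h0 c)).mpr fun c => ?_
  exact (abs_le_of_shellFactor_ne_zero hP hR hf hy c).trans
    (Finset.single_le_sum (f := fun c : CoordIn blk P => ρ * (R ⟨blk c, hP c.2⟩)⁻¹ ^ d c)
      (fun c _ => h0 c) (Finset.mem_univ c))

/-- Below this norm every cutoff is evaluated in [-1, 1], where it equals 1, and the difference in
the second factor vanishes. -/
theorem le_blockNorm_of_shellFactor_ne_zero (hd : ∀ j, 0 < d j) {f : CoordIn blk M → 𝓢(ℝ, ℂ)}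
    {χ : 𝓢(ℝ, ℂ)} {χ' : ℝ → ℝ} (hχ : ∀ x, χ x = χ' x) (hχ1 : ∀ x, |x| ≤ 1 → χ' x = 1)
    {R : {k // k ∈ M} → ℝ} {k₀ : {k // k ∈ P}} {t : ℝ} (ht : 0 < t) {y : CoordIn blk P → ℝ}
    (hy : shellFactor hP f χ R k₀ t d y ≠ 0) :
    t⁻¹ ≤ blockNorm (blkIn blk P) (fun j => d j) k₀ y := by
  by_contra hlt
  refine right_ne_zero_of_mul hy (sub_eq_zero.mpr (Finset.prod_eq_one fun c _ => ?_).symm)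
  split_ifs with hc
  · have h1 := (le_blockNorm (blkIn blk P) (fun j => d j) (Subtype.ext hc) y).trans
      (not_le.mp hlt).le
    have h2 := Real.rpow_le_rpow (by positivity) h1 (hd c).le
    rw [← Real.rpow_mul (abs_nonneg _), one_div_mul_cancel (hd c).ne', Real.rpow_one,
      Real.inv_rpow ht.le] at h2
    have hpos := Real.rpow_pos_of_pos ht (d c)
    rw [hχ, hχ1, Complex.ofReal_one]
    rw [abs_mul, abs_of_pos hpos]
    calc _ ≤ t ^ d c * (t ^ d c)⁻¹ := by gcongr
      _ = 1 := mul_inv_cancel₀ hpos.ne'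
  · rfl

/-- In block `i` the parameter R_j and the inner dilation by R_i/R_j compose to R_i. The second
dilate is therefore the first one times cutoffs at scale 1/R_j, and the factors in M \ P come out of
the difference. -/
theorem dilate_sub_dilate {f : CoordIn blk M → 𝓢(ℝ, ℂ)} {χ : 𝓢(ℝ, ℂ)} {R R' : {k // k ∈ M} → ℝ}
    (hR : ∀ k, 0 < R k) (hR' : ∀ k, 0 < R' k) {i j : {k // k ∈ M}} (hi : (i : κ) ∈ P)
    (hRR' : R' = Function.update R i (R j))
    {ψ ψ' : 𝓢(CoordIn blk M → ℝ, ℂ)} (hψ : ∀ x, ψ x = ∏ c, f c (x c))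
    (hψ' : ∀ x, ψ' x = ∏ c, if blkIn blk M c = i then f c ((R i / R j) ^ d c * x c) * χ (x c)
      else f c (x c))
    {R'' : {k // k ∈ M \ P} → ℝ} (hR'' : ∀ k, 0 < R'' k)
    (hRR'' : ∀ k, R'' k = R ⟨k, (Finset.mem_sdiff.mp k.2).1⟩)
    {ψ'' : 𝓢(CoordIn blk (M \ P) → ℝ, ℂ)}
    (hψ'' : ∀ x, ψ'' x = ∏ c : CoordIn blk (M \ P), f ⟨c, (Finset.mem_sdiff.mp c.2).1⟩ (x c))
    (x : ι → ℝ) :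
    dilate blk d M R hR ψ (projIn blk M x) - dilate blk d M R' hR' ψ' (projIn blk M x) =
      shellFactor hP f χ R i (R j) d (projIn blk P x) *
        dilate blk d (M \ P) R'' hR'' ψ'' (projIn blk (M \ P) x) := by
  have hp : ∀ (S : Finset κ) (c : CoordIn blk S), projIn blk S x c = x c := fun _ _ => rfl
  simp only [dilate_apply, hψ, hψ', hψ'', hp]
  have h1 : ∀ c : CoordIn blk M, (if blkIn blk M c = i then
        f c ((R i / R j) ^ d c * (R' (blkIn blk M c) ^ d c * x c)) * χ (R' (blkIn blk M c) ^ d c * x c)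
      else f c (R' (blkIn blk M c) ^ d c * x c)) =
      f c (R (blkIn blk M c) ^ d c * x c) * if blk c = i then χ (R j ^ d c * x c) else 1 := by
    intro c
    by_cases hc : blkIn blk M c = i
    · have hc' : blk c = i := Subtype.ext_iff.mp hc
      have hpos := (Real.rpow_pos_of_pos (hR j) (d c)).ne'
      rw [if_pos hc, if_pos hc', hc, hRR', Function.update_self,
        Real.div_rpow (hR i).le (hR j).le, ← mul_assoc, div_mul_cancel₀ _ hpos]
    · have hc' : blk c ≠ i := fun h => hc (Subtype.ext h)
      rw [if_neg hc, if_neg hc', hRR', Function.update_of_ne hc, mul_one]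
  simp only [h1]
  rw [Finset.prod_mul_distrib, prod_splitIn blk hP fun c : CoordIn blk M =>
      f c (R (blkIn blk M c) ^ d c * x c),
    prod_splitIn blk hP fun c : CoordIn blk M => if blk c = i then χ (R j ^ d c * x c) else 1]
  have h2 : ∏ c : CoordIn blk (M \ P), (if blk c = i then χ (R j ^ d c * x c) else 1) = 1 :=
    Finset.prod_eq_one fun c _ => by
      rw [if_neg]
      exact fun h => (Finset.mem_sdiff.mp c.2).2 (h ▸ hi)
  have h3 : ∀ c : CoordIn blk (M \ P), R'' (blkIn blk (M \ P) c) =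
      R (blkIn blk M ⟨c, (Finset.mem_sdiff.mp c.2).1⟩) := fun c => hRR'' _
  rw [h2]
  simp only [h3, shellFactor, hp]
  simp only [blkIn]
  ring

/-- Replacing a dilation parameter `R i` by a larger `R j` with `i < j`, and cutting off at the
smaller scale, changes the distribution by one that satisfies the differential inequalities. -/
theorem diffIneqWith_sharp_sub_sharp (hd : ∀ j, 0 < d j) (hsurj : Function.Surjective blk)
    {K : 𝓢'(ι → ℝ, ℂ)} {i j : {k // k ∈ M}} (hij : i < j)
    (hK : ProductCancellation blk d K (M \ {(i : κ), (j : κ)}) fun _ => True) {χ : 𝓢(ℝ, ℂ)}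
    {χ' : ℝ → ℝ} (hχ : ∀ x, χ x = χ' x) (hχ0 : ∀ x, 0 ≤ χ' x) (hχ1 : ∀ x, χ' x ≤ 1)
    (hχ2 : ∀ x, |x| ≤ 1 → χ' x = 1) {ρ : ℝ} (hρ : 2 ≤ ρ) :
    ∃ (C : (m : ℕ) → (Fin m → CoordOut blk M) → ℝ) (p : (m : ℕ) → (Fin m → CoordOut blk M) → ℕ),
      (∀ m s, 0 ≤ C m s) ∧
      ∀ f : CoordIn blk M → 𝓢(ℝ, ℂ), (∀ j, tsupport (f j) ⊆ Metric.closedBall 0 ρ) →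
        ∀ (R : {k // k ∈ M} → ℝ) (hR : ∀ k, 0 < R k) (R' : {k // k ∈ M} → ℝ) (hR' : ∀ k, 0 < R' k),
          R' = Function.update R i (R j) →
          ∀ ψ ψ' : 𝓢(CoordIn blk M → ℝ, ℂ), (∀ x, ψ x = ∏ c, f c (x c)) →
            (∀ x, ψ' x = ∏ c, if blkIn blk M c = i then
              f c ((R i / R j) ^ d c * x c) * χ (x c) else f c (x c)) →
            DiffIneqWith (blkOut blk M) (fun j => d j)
              (sharp blk d K M R hR ψ - sharp blk d K M R' hR' ψ')
              (fun m s => C m s * ∏ c, scalarNorm (p m s) (f c)) := by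
  set P : Finset κ := {(i : κ), (j : κ)} with hPdef
  have hiP : (i : κ) ∈ P := by simp [hPdef]
  have hjP : (j : κ) ∈ P := by simp [hPdef]
  have hP : P ⊆ M := by
    intro k hk
    rcases Finset.mem_insert.mp hk with rfl | hk
    · exact i.2
    · rw [Finset.mem_singleton.mp hk]; exact j.2
  set k₀ : {k // k ∈ P} := ⟨i, hiP⟩ with hk₀
  have hmin : ∀ k : {k // k ∈ P}, k₀ ≤ k := by
    rintro ⟨k, hk⟩
    rcases Finset.mem_insert.mp hk with rfl | hk
    · exact le_rfl
    · rw [Finset.mem_singleton] at hk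
      subst hk
      exact hij.le
  -- The factor `j` has at least one coordinate; this gives the decay that makes the shell integral
  -- converge.
  have hk : ∃ c : CoordIn blk P, blkIn blk P c ≠ k₀ := by
    obtain ⟨c, hc⟩ := hsurj j
    refine ⟨⟨c, hc ▸ hjP⟩, fun h => hij.ne' ?_⟩
    have h1 : blk c = i := Subtype.ext_iff.mp h
    exact Subtype.ext (hc.symm.trans h1)
  obtain ⟨C₁, p₁, hC₁, h₁⟩ := hK ρ hρ
  obtain ⟨C₂, hC₂, h₂⟩ := exists_integral_shell_le (blkIn blk P) (fun j => d j)
    (fun j => hd j) k₀ hk (by linarith : 0 ≤ ρ)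
  refine ⟨fun m s => C₁ m (fun a => splitOut blk hP (Sum.inr (s a))) * C₂,
    fun m s => p₁ m (fun a => splitOut blk hP (Sum.inr (s a))), fun m s => mul_nonneg (hC₁ _ _) hC₂,
    fun f hf R hR R' hR' hRR' ψ ψ' hψ hψ' => ?_⟩
  set f'' : CoordIn blk (M \ P) → 𝓢(ℝ, ℂ) := fun c => f ⟨c, (Finset.mem_sdiff.mp c.2).1⟩ with hf''
  set R'' : {k // k ∈ M \ P} → ℝ := fun k => R ⟨k, (Finset.mem_sdiff.mp k.2).1⟩ with hR''def
  have hR'' : ∀ k, 0 < R'' k := fun k => hR _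
  obtain ⟨ψ'', hψ''⟩ := exists_schwartz_prod (f := f'') (by linarith : 0 ≤ ρ) fun c => hf _
  have hS := h₁ f'' (fun c => hf _) R'' hR'' trivial ψ'' hψ''
  set h := shellFactor hP f χ R i (R j) d with hh
  have hsh : ∀ y, h y ≠ 0 → y ∈ shell (blkIn blk P) (fun j => d j) k₀ ρ (R j)⁻¹ := by
    intro y hy
    refine ⟨le_blockNorm_of_shellFactor_ne_zero hP hd hχ hχ2 (k₀ := k₀) (hR j) hy, fun c hc => ?_⟩
    have h3 := abs_le_of_shellFactor_ne_zero hP hR hf hy c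
    have h4 : (⟨blk c, hP c.2⟩ : {k // k ∈ M}) = j := by
      have h5 := c.2
      rcases Finset.mem_insert.mp h5 with h6 | h6
      · exact absurd (Subtype.ext h6) hc
      · exact Subtype.ext (Finset.mem_singleton.mp h6)
    rwa [h4] at h3
  have hcl := isClosed_shell (blkIn blk P) (fun j => d j) (fun j => hd j) k₀ ρ (R j)⁻¹
  -- The shell is closed, so the lower bound 1/R_j for the norm passes to the closure of the
  -- support.
  have hts : ∀ y ∈ tsupport h, 0 < blockNorm (blkIn blk P) (fun j => d j) k₀ y := fun y hy =>
    (inv_pos.mpr (hR j)).trans_le (closure_minimal (fun y hy => hsh y hy) hcl hy).1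
  have hsm : ContDiff ℝ ∞ h := contDiff_shellFactor hP f χ R i (R j)
  -- One integral, bounded for every `p`: integrability is read off at p = 0, while each derivative
  -- uses the order that `hK` prescribes for it.
  have hint := fun p => h₂ (R j)⁻¹ (inv_pos.mpr (hR j)) (fun y => ‖h y‖)
    (∏ c : CoordIn blk P, scalarNorm p (f ⟨c, hP c.2⟩)) hsm.continuous.norm.measurable
    (fun y => norm_nonneg _) (norm_shellFactor_le hP f hχ hχ0 hχ1 R i (R j) p)
    (fun y hy => hsh y (norm_ne_zero_iff.mp hy))
  have key := diffIneqWith_partial_integral (splitOut blk hP) (blkX := blkOut blk M)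
    (dX := fun j => d j) (fun j => hd j) hS
    (fun m s => mul_nonneg (hC₁ _ _) (Finset.prod_nonneg fun c _ => scalarNorm_nonneg _ _))
    (T := sharp blk d K M R hR ψ - sharp blk d K M R' hR' ψ') hsm
    (hasCompactSupport_shellFactor hP hR (by linarith) hf) (hint 0).1
    (fun y hy x hx => joinCoords_mem_regularSet hP hd hmin (hts y hy) hx)
    (fun y hy x hx m s => flagWeight_joinCoords_le hP hd hmin (hts y hy) hx s) ?_
  · refine key.mono fun m s => ?_
    rw [prod_splitIn blk hP fun c : CoordIn blk M => scalarNorm _ (f c)]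
    have h3 := (hint (p₁ m fun a => splitOut blk hP (Sum.inr (s a)))).2
    have h4 : 0 ≤ ∏ c, scalarNorm (p₁ m fun a => splitOut blk hP (Sum.inr (s a))) (f'' c) :=
      Finset.prod_nonneg fun c _ => scalarNorm_nonneg _ _
    have h5 := hC₁ m fun a => splitOut blk hP (Sum.inr (s a))
    refine (mul_le_mul_of_nonneg_left h3 (mul_nonneg h5 h4)).trans_eq ?_
    ring
  · intro φ φ' hφ'
    change sharp blk d K M R hR ψ φ - sharp blk d K M R' hR' ψ' φ = _
    rw [sharp_apply, sharp_apply, sharp_apply, ← map_sub]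
    congr 1
    ext x
    rw [sub_apply, tensorCLM_apply, tensorCLM_apply, tensorCLM_apply, ← mul_sub,
      dilate_sub_dilate hP hR hR' hiP hRR' hψ hψ' hR'' (fun _ => rfl) hψ'']
    have h3 : projOut blk (M \ P) x = combine (splitOut blk hP) (projIn blk P x, projOut blk M x) :=
      (combine_eta (splitOut blk hP) (projOut blk (M \ P) x)).symm
    rw [h3, hφ']
    ring

end Remainder

/-! ### Making R decreasing by successive replacements. -/

section Reordering

variable {σ : Type*} [LinearOrder σ] [Fintype σ]

open Classical in
/-- The indices at which `R` is exceeded by a later value. -/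
def ascents (R : σ → ℝ) : Finset σ := {t | ∃ u, t < u ∧ R t < R u}

theorem mem_ascents {R : σ → ℝ} {t : σ} : t ∈ ascents R ↔ ∃ u, t < u ∧ R t < R u := by
  simp [ascents]

theorem antitone_of_ascents_eq_empty {R : σ → ℝ} (h : ascents R = ∅) : Antitone R := by
  intro a b hab
  by_contra hlt
  have hne : a ≠ b := by rintro rfl; exact hlt le_rfl
  have : a ∈ ascents R := mem_ascents.mpr ⟨b, lt_of_le_of_ne hab hne, not_le.mp hlt⟩
  simp [h] at this

/-- Raise R_i to the largest later value R_j. Then `i` is no longer an ascent. No ascent is created: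
an index before `i` that the new value exceeds was already exceeded at `j`, which is later still. -/
theorem exists_card_ascents_update_lt [DecidableEq σ] {R : σ → ℝ} (h : ascents R ≠ ∅) :
    ∃ i j, i < j ∧ R i < R j ∧
      (ascents (Function.update R i (R j))).card < (ascents R).card := by
  obtain ⟨i, hi⟩ := Finset.nonempty_iff_ne_empty.mpr h
  obtain ⟨u, hiu, hRu⟩ := mem_ascents.mp hi
  obtain ⟨j, hj, hmax⟩ := Finset.exists_max_image (Finset.univ.filter (i < ·)) R
    ⟨u, by simpa using hiu⟩
  have hij : i < j := by simpa using hj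
  have hmax' : ∀ t, i < t → R t ≤ R j := fun t ht => hmax t (by simpa using ht)
  have hRij : R i < R j := hRu.trans_le (hmax' u hiu)
  refine ⟨i, j, hij, hRij, Finset.card_lt_card (Finset.ssubset_iff_of_subset ?_ |>.mpr ⟨i, hi, ?_⟩)⟩
  · intro t ht
    obtain ⟨v, htv, hR⟩ := mem_ascents.mp ht
    rw [mem_ascents]
    by_cases hti : t = i
    · exact hti ▸ ⟨j, hij, hRij⟩
    · rw [Function.update_of_ne hti] at hR
      by_cases hvi : v = i
      · rw [hvi, Function.update_self] at hR
        exact ⟨j, (hvi ▸ htv).trans hij, hR⟩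
      · rw [Function.update_of_ne hvi] at hR
        exact ⟨v, htv, hR⟩
  · intro ht
    obtain ⟨v, htv, hR⟩ := mem_ascents.mp ht
    rw [Function.update_self, Function.update_of_ne htv.ne'] at hR
    exact absurd hR (not_lt.mpr (hmax' v htv))

end Reordering

/-! ### The double induction for products. -/

section Induction

variable {ι κ : Type*} [Fintype ι] [DecidableEq ι] [LinearOrder κ] [Fintype κ]
  {blk : ι → κ} {d : ι → ℝ}

theorem exists_schwartz_mul_comp (f χ : 𝓢(ℝ, ℂ)) (hχ : HasCompactSupport χ) (t : ℝ) :
    ∃ g : 𝓢(ℝ, ℂ), ∀ x, g x = f (t * x) * χ x := by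
  have h1 : ContDiff ℝ ∞ fun x => f (t * x) * χ x :=
    ((f.smooth ⊤).comp (contDiff_const.mul contDiff_id)).mul (χ.smooth ⊤)
  have h2 : HasCompactSupport fun x => f (t * x) * χ x := hχ.mul_left
  exact ⟨h2.toSchwartzMap h1, fun _ => rfl⟩

theorem scalarNorm_prod_mono {J : Type*} [Fintype J] {f : J → 𝓢(ℝ, ℂ)} {p q : ℕ} (h : p ≤ q) :
    ∏ c, scalarNorm p (f c) ≤ ∏ c, scalarNorm q (f c) :=
  Finset.prod_le_prod (fun _ _ => scalarNorm_nonneg _ _) fun _ _ => scalarNorm_mono h _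

/-- With no ascents R is decreasing. Otherwise one replacement splits the distribution into a term
with fewer ascents and a remainder governed by the smaller set M \ {i, j}. -/
theorem productCancellation_card_ascents (hd : ∀ j, 0 < d j) (hsurj : Function.Surjective blk)
    {K : 𝓢'(ι → ℝ, ℂ)} {M : Finset κ} (hK : ProductCancellation blk d K M Antitone)
    (hsmaller : ∀ P : Finset κ, P ⊂ M → ProductCancellation blk d K P fun _ => True) (n : ℕ) :
    ProductCancellation blk d K M fun R => (ascents R).card ≤ n := by
  induction n with
  | zero =>
    intro ρ hρ
    obtain ⟨C, p, hC, h⟩ := hK ρ hρ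
    refine ⟨C, p, hC, fun f hf R hR hadm => h f hf R hR (antitone_of_ascents_eq_empty ?_)⟩
    exact Finset.card_eq_zero.mp (Nat.le_zero.mp hadm)
  | succ n ih =>
    intro ρ hρ
    -- This cutoff lives in [-2, 2]. Since ρ ≥ 2, the truncated functions stay supported in the ball
    -- of radius ρ, and the induction hypothesis applies with the same ρ.
    obtain ⟨χ, χ', hχ, hχ0, hχ1, hχ2, hχs⟩ := exists_cutoff one_pos
    rw [mul_one] at hχs
    have hχc : HasCompactSupport χ :=
      (isCompact_closedBall _ _).of_isClosed_subset (isClosed_tsupport _) hχs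
    obtain ⟨C₀, p₀, hC₀, h₀⟩ := ih ρ hρ
    have hpair : ∀ i j : {k // k ∈ M}, i < j →
        ProductCancellation blk d K (M \ {(i : κ), (j : κ)}) fun _ => True := by
      intro i j _
      refine hsmaller _ (Finset.sdiff_ssubset ?_ ⟨i, by simp⟩)
      intro k hk
      rcases Finset.mem_insert.mp hk with rfl | hk
      · exact i.2
      · rw [Finset.mem_singleton.mp hk]; exact j.2
    -- The pair (i, j) depends on R, but there are finitely many pairs, so summing over all of them
    -- gives constants independent of R. For pairs with i ≥ j the chosen values are arbitrary, hence
    -- the absolute values below.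
    choose! C₁ p₁ hC₁ h₁ using fun (i j : {k // k ∈ M}) (hij : i < j) =>
      diffIneqWith_sharp_sub_sharp hd hsurj hij (hpair i j hij) hχ hχ0 hχ1 hχ2 hρ
    -- The cost of truncation per coordinate; the 1 covers coordinates outside block `i`, whose
    -- functions do not change.
    set A : ℕ → ℝ := fun q => max 1 ((q + 1) * 2 ^ q * scalarNorm q χ) with hA
    have hA1 : ∀ q, 1 ≤ A q := fun q => le_max_left _ _
    have hA0 : ∀ q, 0 ≤ A q := fun q => zero_le_one.trans (hA1 q)
    set D : (m : ℕ) → (Fin m → CoordOut blk M) → ℝ := fun m s =>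
      C₀ m s * A (p₀ m s) ^ Fintype.card (CoordIn blk M) with hD
    set q : (m : ℕ) → (Fin m → CoordOut blk M) → ℕ := fun m s =>
      p₀ m s + ∑ i, ∑ j, p₁ i j m s with hq
    have hD0 : ∀ m s, 0 ≤ D m s := fun m s => mul_nonneg (hC₀ _ _) (pow_nonneg (hA0 _) _)
    have hab0 : ∀ m s, ∀ i j, 0 ≤ |C₁ i j m s| := fun m s i j => abs_nonneg _
    refine ⟨fun m s => D m s + ∑ i, ∑ j, |C₁ i j m s|, q, fun m s => add_nonneg (hD0 m s)
      (Finset.sum_nonneg fun i _ => Finset.sum_nonneg fun j _ => hab0 m s i j),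
      fun f hf R hR hadm ψ hψ => ?_⟩
    have hf0 : ∀ p, 0 ≤ ∏ c, scalarNorm p (f c) := fun p =>
      Finset.prod_nonneg fun c _ => scalarNorm_nonneg _ _
    have hq0 : ∀ m s, p₀ m s ≤ q m s := fun m s => Nat.le_add_right _ _
    by_cases hasc : ascents R = ∅
    · refine (h₀ f hf R hR (by simp [hasc]) ψ hψ).mono fun m s => ?_
      have h3 : 0 ≤ ∑ i, ∑ j, |C₁ i j m s| :=
        Finset.sum_nonneg fun i _ => Finset.sum_nonneg fun j _ => hab0 m s i j
      have h4 : C₀ m s ≤ D m s := by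
        have := mul_le_mul_of_nonneg_left (one_le_pow₀ (hA1 (p₀ m s)) (n := Fintype.card
          (CoordIn blk M))) (hC₀ m s)
        rwa [mul_one] at this
      exact mul_le_mul (by linarith) (scalarNorm_prod_mono (hq0 m s)) (hf0 _)
        (add_nonneg (hD0 m s) h3)
    · obtain ⟨i, j, hij, hRij, hcard⟩ := exists_card_ascents_update_lt hasc
      have hR' : ∀ k, 0 < Function.update R i (R j) k := by
        intro k
        by_cases hk : k = i
        · rw [hk, Function.update_self]; exact hR j
        · rw [Function.update_of_ne hk]; exact hR k
      have hex : ∀ c : CoordIn blk M, ∃ g : 𝓢(ℝ, ℂ), ∀ x, g x = if blkIn blk M c = i then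
          f c ((R i / R j) ^ d c * x) * χ x else f c x := by
        intro c
        by_cases hc : blkIn blk M c = i
        · simpa only [if_pos hc] using exists_schwartz_mul_comp (f c) χ hχc _
        · exact ⟨f c, fun x => by rw [if_neg hc]⟩
      choose f' hf' using hex
      have hf's : ∀ c, tsupport (f' c) ⊆ Metric.closedBall 0 ρ := by
        intro c
        refine closure_minimal (fun x hx => ?_) Metric.isClosed_closedBall
        rw [Function.mem_support, hf'] at hx
        split_ifs at hx
        · exact Metric.closedBall_subset_closedBall hρ
            (hχs (subset_tsupport _ (right_ne_zero_of_mul hx)))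
        · exact hf c (subset_tsupport _ hx)
      obtain ⟨ψ', hψ'⟩ := exists_schwartz_prod (by linarith : 0 ≤ ρ) hf's
      have hmain := h₀ f' hf's _ hR' (by omega) ψ' hψ'
      have hrem := h₁ i j hij f hf R hR _ hR' rfl ψ ψ' hψ fun x => by simp only [hψ', hf']
      refine (hmain.add hrem fun φ => ?_).mono fun m s => ?_
      · exact (add_sub_cancel _ _).symm
      · have hnorm : ∏ c, scalarNorm (p₀ m s) (f' c) ≤
            A (p₀ m s) ^ Fintype.card (CoordIn blk M) * ∏ c, scalarNorm (p₀ m s) (f c) := by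
          rw [← Finset.card_univ, ← Finset.prod_const, ← Finset.prod_mul_distrib]
          refine Finset.prod_le_prod (fun c _ => scalarNorm_nonneg _ _) fun c _ => ?_
          by_cases hc : blkIn blk M c = i
          · have ht : |(R i / R j) ^ d c| ≤ 1 := by
              have h5 : 0 ≤ R i / R j := (div_pos (hR i) (hR j)).le
              rw [abs_of_nonneg (Real.rpow_nonneg h5 _)]
              exact Real.rpow_le_one h5 ((div_le_one (hR j)).mpr hRij.le) (hd c).le
            refine (scalarNorm_mul_comp_le (p₀ m s) (f := f c) (χ := χ) ht fun x => by rw [hf', if_pos hc]).trans ?_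
            exact mul_le_mul_of_nonneg_right (le_max_right _ _) (scalarNorm_nonneg _ _)
          · have : f' c = f c := by ext x; rw [hf', if_neg hc]
            rw [this]
            exact le_mul_of_one_le_left (scalarNorm_nonneg _ _) (hA1 _)
        have hp : p₁ i j m s ≤ q m s := by
          have h5 : p₁ i j m s ≤ ∑ j, p₁ i j m s :=
            Finset.single_le_sum (f := fun j => p₁ i j m s) (fun _ _ => Nat.zero_le _)
              (Finset.mem_univ j)
          have h6 : ∑ j, p₁ i j m s ≤ ∑ i, ∑ j, p₁ i j m s :=
            Finset.single_le_sum (f := fun i => ∑ j, p₁ i j m s) (fun _ _ => Nat.zero_le _)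
              (Finset.mem_univ i)
          exact (h5.trans h6).trans (Nat.le_add_left _ _)
        have hC : C₁ i j m s ≤ ∑ i, ∑ j, |C₁ i j m s| := by
          have h5 : |C₁ i j m s| ≤ ∑ j, |C₁ i j m s| :=
            Finset.single_le_sum (f := fun j => |C₁ i j m s|) (fun _ _ => abs_nonneg _)
              (Finset.mem_univ j)
          have h6 : ∑ j, |C₁ i j m s| ≤ ∑ i, ∑ j, |C₁ i j m s| :=
            Finset.single_le_sum (f := fun i => ∑ j, |C₁ i j m s|)
              (fun _ _ => Finset.sum_nonneg fun _ _ => abs_nonneg _) (Finset.mem_univ i)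
          exact (le_abs_self _).trans (h5.trans h6)
        rw [add_mul]
        refine add_le_add ?_ ?_
        · calc _ ≤ C₀ m s * (A (p₀ m s) ^ Fintype.card (CoordIn blk M) *
                ∏ c, scalarNorm (p₀ m s) (f c)) := mul_le_mul_of_nonneg_left hnorm (hC₀ m s)
            _ = D m s * ∏ c, scalarNorm (p₀ m s) (f c) := by rw [hD]; ring
            _ ≤ _ := mul_le_mul_of_nonneg_left (scalarNorm_prod_mono (hq0 m s)) (hD0 m s)
        · exact mul_le_mul hC (scalarNorm_prod_mono hp) (hf0 _)
            (Finset.sum_nonneg fun i _ => Finset.sum_nonneg fun j _ => hab0 m s i j)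

/-- Strong induction on M. The number of ascents never exceeds the number of factors in M, so that
bound covers every R. -/
theorem productCancellation_of_antitone (hd : ∀ j, 0 < d j) (hsurj : Function.Surjective blk)
    {K : 𝓢'(ι → ℝ, ℂ)} (hK : ∀ M : Finset κ, ProductCancellation blk d K M Antitone)
    (M : Finset κ) : ProductCancellation blk d K M fun _ => True := by
  induction M using Finset.strongInduction with
  | H M ih =>
    intro ρ hρ
    obtain ⟨C, p, hC, h⟩ := productCancellation_card_ascents hd hsurj (hK M) ih
      (Fintype.card {k // k ∈ M}) ρ hρ
    exact ⟨C, p, hC, fun f hf R hR _ => h f hf R hR (Finset.card_le_univ _)⟩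

end Induction

/-! ### Convergent series of kernels. -/

section Series

variable {ι κ : Type*} [Fintype ι] [DecidableEq ι] [LinearOrder κ] [Fintype κ]
  {blk : ι → κ} {d : ι → ℝ}

theorem DiffIneqWith.smul {S T : 𝓢'(ι → ℝ, ℂ)} {C : (m : ℕ) → (Fin m → ι) → ℝ}
    (h : DiffIneqWith blk d S C) (c : ℂ) (hT : ∀ φ, T φ = c * S φ) :
    DiffIneqWith blk d T fun m s => ‖c‖ * C m s := by
  obtain ⟨F, ⟨hF, hS⟩, hb⟩ := h
  refine ⟨fun x => c • F x, ⟨ContDiffOn.const_smul c hF, fun φ hc hs => ?_⟩, fun m s x hx => ?_⟩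
  · rw [hT, hS φ hc hs, ← integral_const_mul]
    simp only [smul_eq_mul, mul_assoc]
  · have hm : (m : WithTop ℕ∞) ≤ ∞ := mod_cast le_top
    unfold partialDeriv
    rw [iteratedFDeriv_const_smul_apply' (a := c)
      ((hF.contDiffAt ((isOpen_regularSet blk).mem_nhds hx)).of_le hm), smul_apply, norm_smul,
      mul_assoc]
    exact mul_le_mul_of_nonneg_left (hb m s x hx) (norm_nonneg _)

/-- A series is a superposition with respect to counting measure, so `diffIneqWith_integral`
applies. -/
theorem diffIneqWith_tsum (hd : ∀ j, 0 < d j) {α : Type*} [Countable α] {T : 𝓢'(ι → ℝ, ℂ)}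
    {S : α → 𝓢'(ι → ℝ, ℂ)} {C : α → (m : ℕ) → (Fin m → ι) → ℝ}
    (hS : ∀ a, DiffIneqWith blk d (S a) (C a)) (hC : ∀ m s, Summable fun a => C a m s)
    (hT : ∀ φ, HasSum (fun a => S a φ) (T φ)) :
    DiffIneqWith blk d T fun m s => ∑' a, C a m s := by
  let _ : MeasurableSpace α := ⊤
  have _ : DiscreteMeasurableSpace α := ⟨fun _ => trivial⟩
  choose F hF hb using hS
  have hint : ∀ {V : Type} [NormedAddCommGroup V] [NormedSpace ℝ V] [CompleteSpace V] {f : α → V},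
      Summable (fun a => ‖f a‖) → ∫ a, f a ∂Measure.count = ∑' a, f a := by
    intro V _ _ _ f hf
    rw [integral_countable (integrable_count_iff.mpr hf)]
    simp [Measure.real]
  have key := diffIneqWith_integral (blk := blk) (μ := (Measure.count : Measure α)) (T := T)
    (G := F) (b := fun m s a => C a m s) hd (fun a => (hF a).1)
    (fun m s => integrable_count_iff.mpr (hC m s).norm) (fun a m s x hx => hb a m s x hx)
    (fun m x _ => StronglyMeasurable.of_discrete.aestronglyMeasurable) ?_ ?_
  · refine key.mono fun m s => ?_
    rw [hint (hC m s).norm]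
  · intro φ hφc hφs
    refine (measurable_from_prod_countable_right fun a => ?_).aestronglyMeasurable
    exact (integrable_mul_of_contDiffOn (isOpen_regularSet blk) (hF a).1.continuousOn φ.continuous
      hφc hφs).1.measurable
  · intro φ hφc hφs
    have h1 : (fun a => ∫ x, F a x * φ x) = fun a => S a φ :=
      funext fun a => ((hF a).2 φ hφc hφs).symm
    rw [h1, hint (hT φ).summable.norm, (hT φ).tsum_eq]

end Series

/-! ### Convergence of series in the Schwartz topology. -/

section SchwartzSeries

variable {E : Type*} [NormedAddCommGroup E] [NormedSpace ℝ E]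

/-- Summable seminorms allow termwise differentiation, and each seminorm of the error is at most the
tail of the corresponding series. -/
theorem hasSum_schwartz {α : Type*} {a : α → 𝓢(E, ℂ)} {f : 𝓢(E, ℂ)}
    (hsum : ∀ k l, Summable fun n => SchwartzMap.seminorm ℂ k l (a n))
    (hf : ∀ x, HasSum (fun n => a n x) (f x)) : HasSum a f := by
  have hfun : (f : E → ℂ) = fun x => ∑' n, a n x := funext fun x => (hf x).tsum_eq.symm
  have hder : ∀ l x, HasSum (fun n => iteratedFDeriv ℝ l (a n) x) (iteratedFDeriv ℝ l f x) := by
    intro l x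
    have h1 : ∀ n, ‖iteratedFDeriv ℝ l (a n) x‖ ≤ SchwartzMap.seminorm ℂ 0 l (a n) := fun n => by
      simpa using SchwartzMap.le_seminorm ℂ 0 l (a n) x
    rw [hfun, iteratedFDeriv_tsum_apply (N := ⊤) (fun n => (a n).smooth ⊤) (fun k _ => hsum 0 k)
      (fun k n x _ => by simpa using SchwartzMap.le_seminorm ℂ 0 k (a n) x) le_top x]
    exact (Summable.of_norm_bounded (hsum 0 l) h1).hasSum
  refine ((schwartz_withSeminorms ℂ E ℂ).tendsto_nhds _ _).mpr fun kl ε hε => ?_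
  obtain ⟨k, l⟩ := kl
  have htail := tendsto_tsum_compl_atTop_zero fun n => SchwartzMap.seminorm ℂ k l (a n)
  filter_upwards [htail.eventually (gt_mem_nhds hε)] with s hs
  refine lt_of_le_of_lt ?_ hs
  refine SchwartzMap.seminorm_le_bound ℂ k l _ (tsum_nonneg fun n => apply_nonneg _ _) fun x => ?_
  have hsub : iteratedFDeriv ℝ l (∑ n ∈ s, a n - f : 𝓢(E, ℂ)) x =
      -∑' n : {n // n ∉ s}, iteratedFDeriv ℝ l (a n) x := by
    have h1 : ((∑ n ∈ s, a n - f : 𝓢(E, ℂ)) : E → ℂ) =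
        (fun x => ∑ n ∈ s, a n x) - (f : E → ℂ) := by
      ext y; simp
    have h2 : ∀ n ∈ s, ContDiffAt ℝ l (a n : E → ℂ) x := fun n _ => ((a n).smooth l).contDiffAt
    rw [h1, iteratedFDeriv_sub_apply (ContDiffAt.sum h2) (f.smooth l).contDiffAt,
      iteratedFDeriv_fun_sum_apply h2, ← (hder l x).summable.sum_add_tsum_subtype_compl s |>.trans (hder l x).tsum_eq]
    simp
  have hcs := ((hder l x).summable.subtype (fun n => n ∉ s)).hasSum.const_smul (‖x‖ ^ k)
  have hle := tsum_of_norm_bounded ((hsum k l).subtype (fun n => n ∉ s)).hasSum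
    (f := fun n : {n // n ∉ s} => (‖x‖ ^ k) • iteratedFDeriv ℝ l (a n) x) fun n => by
      rw [norm_smul, norm_pow, norm_norm]
      exact SchwartzMap.le_seminorm ℂ k l (a n) x
  have heq : ∑' n : {n // n ∉ s}, (‖x‖ ^ k) • iteratedFDeriv ℝ l (a n) x =
      (‖x‖ ^ k) • ∑' n : {n // n ∉ s}, iteratedFDeriv ℝ l (a n) x := hcs.tsum_eq
  rw [heq, norm_smul, norm_pow, norm_norm] at hle
  rw [hsub, norm_neg]
  exact hle

end SchwartzSeries

/-! ### Summability over the integer lattice. -/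

section Lattice

variable (J : Type*) [Fintype J]

theorem exists_summable_inv_one_add_norm_pow :
    ∃ N : ℕ, Summable fun n : J → ℤ => ((1 + ‖n‖) ^ N)⁻¹ := by
  classical
  set L : Submodule ℤ (J → ℝ) := Submodule.span ℤ (range (Pi.basisFun ℝ J)) with hL
  set N := Module.finrank ℤ L + 1
  have hmem : ∀ n : J → ℤ, (fun j => (n j : ℝ)) ∈ L := by
    intro n
    refine ((Pi.basisFun ℝ J).mem_span_iff_repr_mem ℤ _).mpr fun j => ⟨n j, by simp⟩
  have hsum := ZLattice.summable_norm_pow_inv L N (Nat.lt_succ_self _)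
  have hinj : Function.Injective fun n : J → ℤ => (⟨fun j => (n j : ℝ), hmem n⟩ : L) := by
    intro n n' h
    funext j
    have h1 : (n j : ℝ) = n' j := congrFun (Subtype.ext_iff.mp h) j
    exact_mod_cast h1
  have hnorm : ∀ n : J → ℤ, ‖(⟨fun j => (n j : ℝ), hmem n⟩ : L)‖ = ‖n‖ := by
    intro n
    refine le_antisymm ((pi_norm_le_iff_of_nonneg (norm_nonneg _)).mpr fun j => ?_)
      ((pi_norm_le_iff_of_nonneg (norm_nonneg _)).mpr fun j => ?_)
    · exact norm_le_pi_norm n j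
    · exact norm_le_pi_norm (fun j => (n j : ℝ)) j
  refine ⟨N, Summable.of_norm_bounded_eventually (hsum.comp_injective hinj) ?_⟩
  -- The comparison with ‖n‖^{-N} can fail only at n = 0, where the inverse of 0 is 0 by convention.
  refine (Set.finite_singleton (0 : J → ℤ)).subset fun n hn => ?_
  by_contra h0
  refine hn ?_
  have hpos : 0 < ‖n‖ := norm_pos_iff.mpr h0
  simp only [Function.comp_apply, hnorm, Set.mem_ofPred_eq]
  rw [Real.norm_of_nonneg (by positivity), inv_pow]
  gcongr
  linarith

end Lattice

/-! ### Decay of the Fourier transform. -/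

section FourierDecay

variable {J : Type*} [Fintype J]

/-- The bilinear form `∑ v_j w_j`. -/
def dotForm (J : Type*) [Fintype J] : (J → ℝ) →L[ℝ] (J → ℝ) →L[ℝ] ℝ :=
  ∑ j, (ContinuousLinearMap.proj j : (J → ℝ) →L[ℝ] ℝ).smulRight
    (ContinuousLinearMap.proj j : (J → ℝ) →L[ℝ] ℝ)

theorem dotForm_apply (v w : J → ℝ) : dotForm J v w = ∑ j, v j * w j := by
  simp [dotForm]

/-- The Fourier transform on `ℝ^J`. -/
def fourierCoeffFun (g : (J → ℝ) → ℂ) (w : J → ℝ) : ℂ :=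
  VectorFourier.fourierIntegral Real.fourierChar volume (dotForm J).toLinearMap₁₂ g w

theorem norm_fourierCoeffFun_le (g : (J → ℝ) → ℂ) (w : J → ℝ) :
    ‖fourierCoeffFun g w‖ ≤ ∫ v, ‖g v‖ :=
  VectorFourier.norm_fourierIntegral_le_integral_norm _ _ _ _ _

/-- Differentiating `q` times in direction `j` multiplies the transform by (2πi w_j)^q up to sign;
the factor 2π ≥ 1 is discarded. -/
theorem abs_pow_mul_norm_fourierCoeffFun_le [DecidableEq J] {g : (J → ℝ) → ℂ} (hg : ContDiff ℝ ∞ g)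
    (hc : HasCompactSupport g) (w : J → ℝ) (j : J) (q : ℕ) :
    |w j| ^ q * ‖fourierCoeffFun g w‖ ≤ ∫ v, ‖partialDeriv (fun _ : Fin q => j) g v‖ := by
  have hint : ∀ n : ℕ, Integrable (iteratedFDeriv ℝ n g) := fun n =>
    (hg.continuous_iteratedFDeriv (m := n) (mod_cast le_top)).integrable_of_hasCompactSupport
      (hc.iteratedFDeriv n)
  have h1 := VectorFourier.fourierIntegral_iteratedFDeriv (dotForm J) (μ := volume) (N := ⊤) hg
    (fun n _ => hint n) (n := q) le_top
  have h2 := congrFun h1 w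
  have h3 := congrArg (fun T => T fun _ : Fin q => (Pi.single j 1 : J → ℝ)) h2
  rw [Real.fourierIntegral_continuousMultilinearMap_apply' (hint q),
    VectorFourier.fourierPowSMulRight_apply] at h3
  have h4 := VectorFourier.norm_fourierIntegral_le_integral_norm Real.fourierChar volume
    (dotForm J).toLinearMap₁₂ (fun x => iteratedFDeriv ℝ q g x fun _ : Fin q => Pi.single j 1) w
  rw [h3] at h4
  refine le_trans ?_ h4
  have hL : (-(dotForm J).flip) w (Pi.single j 1) = -w j := by
    simp [ContinuousLinearMap.flip_apply, dotForm_apply, Pi.single_apply]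
  rw [Finset.prod_const, hL, Finset.card_univ, Fintype.card_fin, norm_smul, norm_smul, norm_pow,
    norm_pow, norm_neg, norm_neg, Real.norm_eq_abs]
  have h5 : (1 : ℝ) ≤ ‖(2 * Real.pi * Complex.I : ℂ)‖ := by
    simp only [norm_mul, Complex.norm_I, mul_one, Complex.norm_real, Complex.norm_ofNat]
    rw [Real.norm_of_nonneg Real.pi_pos.le]
    linarith [Real.pi_gt_three]
  exact le_mul_of_one_le_left (by positivity) (one_le_pow₀ h5)

end FourierDecay

/-! ### Fourier series of functions supported in a small cube. -/

section Torus

variable {J : Type*} [Fintype J]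

/-- The coordinate is folded back to 0 at ±1/2, so that it closes up continuously on the circle.
With the cutoff below it transplants a function from the cube to the torus. -/
theorem exists_circle_coordinate : ∃ Q : C(UnitAddCircle, ℝ), ∀ x : ℝ, |x| ≤ 1 / 4 → Q x = x := by
  let f : ℝ → ℝ := fun x => max (-(1 / 2 - |x|)) (min x (1 / 2 - |x|))
  have hf : Continuous f := by fun_prop
  have hends : f (-(1 / 2)) = f (-(1 / 2) + 1) := by
    simp only [f]; norm_num [abs_of_nonneg, abs_of_nonpos]
  refine ⟨⟨AddCircle.liftIco 1 (-(1 / 2)) f, AddCircle.liftIco_continuous hends hf.continuousOn⟩,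
    fun x hx => ?_⟩
  obtain ⟨h1, h2⟩ := abs_le.mp hx
  have hx' : x ∈ Ico (-(1 / 2) : ℝ) (-(1 / 2) + 1) := ⟨by linarith, by linarith⟩
  refine (AddCircle.liftIco_coe_apply (f := f) hx').trans ?_
  simp only [f]
  have ha : x ≤ 1 / 2 - |x| := by linarith
  have hb : -(1 / 2 - |x|) ≤ x := by linarith
  rw [min_eq_left ha, max_eq_right hb]

theorem exists_circle_cutoff : ∃ U : C(UnitAddCircle, ℝ), ∀ x : ℝ, |x| ≤ 1 / 2 →
    (|x| ≤ 1 / 8 → U x = 1) ∧ (1 / 4 ≤ |x| → U x = 0) := by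
  let f : ℝ → ℝ := fun x => max 0 (min 1 (2 - 8 * |x|))
  have hf : Continuous f := by fun_prop
  have hends : f (-(1 / 2)) = f (-(1 / 2) + 1) := by
    simp only [f]; norm_num [abs_of_nonneg, abs_of_nonpos]
  refine ⟨⟨AddCircle.liftIco 1 (-(1 / 2)) f, AddCircle.liftIco_continuous hends hf.continuousOn⟩,
    fun x hx => ?_⟩
  obtain ⟨h1, h2⟩ := abs_le.mp hx
  have hval : AddCircle.liftIco 1 (-(1 / 2)) f x = f x := by
    rcases h2.lt_or_eq with h2 | h2
    · exact AddCircle.liftIco_coe_apply ⟨h1, by linarith⟩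
    · have h3 : ((1 / 2 : ℝ) : UnitAddCircle) = ((-(1 / 2) : ℝ) : UnitAddCircle) := by
        rw [← AddCircle.coe_add_period (1 : ℝ) (-(1 / 2))]; norm_num
      rw [h2, h3, AddCircle.liftIco_coe_apply ⟨le_rfl, by norm_num⟩, hends]
      norm_num
  constructor
  · intro h
    refine hval.trans ?_
    simp only [f]
    rw [min_eq_left (by linarith), max_eq_right zero_le_one]
  · intro h
    refine hval.trans ?_
    simp only [f]
    rw [max_eq_left ((min_le_right _ _).trans (by linarith))]

theorem mFourier_coe (n : J → ℤ) (x : J → ℝ) :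
    UnitAddTorus.mFourier n (fun j => (x j : UnitAddCircle)) =
      ∏ j, Complex.exp (2 * Real.pi * Complex.I * n j * x j) := by
  simp only [UnitAddTorus.mFourier, ContinuousMap.coe_mk]
  exact Finset.prod_congr rfl fun j _ => by rw [fourier_coe_apply]; simp

/-- The Fourier series of a function supported in a small cube. -/
theorem hasSum_fourier_of_support {g : (J → ℝ) → ℂ} (hg : Continuous g)
    (hs : ∀ x, g x ≠ 0 → ∀ j, |x j| ≤ 1 / 8)
    (hsum : Summable fun n : J → ℤ => fourierCoeffFun g fun j => (n j : ℝ)) {x : J → ℝ}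
    (hx : ∀ j, |x j| ≤ 1 / 2) :
    HasSum (fun n : J → ℤ => fourierCoeffFun g (fun j => (n j : ℝ)) *
      ∏ j, Complex.exp (2 * Real.pi * Complex.I * n j * x j)) (g x) := by
  obtain ⟨Q, hQ⟩ := exists_circle_coordinate
  obtain ⟨U, hU⟩ := exists_circle_cutoff
  -- Beyond 1/4 the folded coordinate could re-enter the support of `g`; the cutoffs remove those
  -- spurious copies.
  let G : C(UnitAddTorus J, ℂ) := ⟨fun t => g (fun j => Q (t j)) * ∏ j, (U (t j) : ℂ), by fun_prop⟩
  have hG : ∀ x : J → ℝ, (∀ j, |x j| ≤ 1 / 2) → G (fun j => (x j : UnitAddCircle)) = g x := by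
    intro x hx
    change g (fun j => Q (x j)) * ∏ j, (U (x j) : ℂ) = g x
    by_cases h4 : ∀ j, |x j| < 1 / 4
    · have h5 : (fun j => Q (x j : UnitAddCircle)) = x := funext fun j => hQ _ (h4 j).le
      rw [h5]
      by_cases h0 : g x = 0
      · rw [h0, zero_mul]
      · rw [Finset.prod_eq_one, mul_one]
        intro j _
        rw [(hU (x j) (hx j)).1 (hs x h0 j), Complex.ofReal_one]
    · push Not at h4
      obtain ⟨j, hj⟩ := h4
      have h0 : g x = 0 := by
        by_contra h0
        linarith [hs x h0 j]
      rw [h0, Finset.prod_eq_zero (Finset.mem_univ j), mul_zero]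
      rw [(hU (x j) (hx j)).2 hj, Complex.ofReal_zero]
  have hcoeff : UnitAddTorus.mFourierCoeff G = fun n : J → ℤ =>
      fourierCoeffFun g fun j => (n j : ℝ) := by
    funext n
    rw [UnitAddTorus.mFourierCoeff_eq_integral G n fun _ => -(1 / 2)]
    set S : Set (J → ℝ) := {x : J → ℝ | ∀ i, x i ∈ Ioc (-(1 / 2) : ℝ) (-(1 / 2) + 1)} with hSdef
    have hS : MeasurableSet S := MeasurableSet.univ_pi' fun _ => measurableSet_Ioc
    have hzero : ∀ x, x ∉ S → g x = 0 := by
      intro x hxS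
      by_contra h0
      refine hxS fun j => ?_
      have := abs_le.mp (hs x h0 j)
      constructor <;> linarith [this.1, this.2]
    have h1 : (∫ v in S, Real.fourierChar (-dotForm J v fun j => (n j : ℝ)) • g v) =
        fourierCoeffFun g fun j => (n j : ℝ) :=
      setIntegral_eq_integral_of_forall_compl_eq_zero fun x hxS => by rw [hzero x hxS, smul_zero]
    refine (setIntegral_congr_fun hS fun v hv => ?_).trans h1
    have hv' : ∀ j, |v j| ≤ 1 / 2 := fun j => by
      have := hv j
      rw [abs_le]; constructor <;> linarith [this.1, this.2]
    rw [hG v hv', mFourier_coe, Circle.smul_def, Real.fourierChar_apply, ← Complex.exp_sum]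
    congr 2
    rw [dotForm_apply]
    push_cast
    rw [← Finset.sum_neg_distrib, Finset.mul_sum, Finset.sum_mul]
    refine Finset.sum_congr rfl fun j _ => ?_
    simp only [Pi.neg_apply]
    push_cast
    ring
  have key := UnitAddTorus.hasSum_mFourier_series_apply_of_summable (f := G)
    (by rw [hcoeff]; exact hsum) fun j => (x j : UnitAddCircle)
  rw [hcoeff, hG x hx] at key
  simpa only [smul_eq_mul, mFourier_coe] using key

end Torus

/-! ### Cut-off characters and their norms. -/

section Modulation

theorem iteratedDeriv_cexp_mul_I (n : ℕ) (ξ : ℝ) :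
    (iteratedDeriv n fun x : ℝ => Complex.exp (ξ * x * Complex.I)) =
      fun x : ℝ => (ξ * Complex.I) ^ n * Complex.exp (ξ * x * Complex.I) := by
  induction n with
  | zero => simp
  | succ n ih =>
    rw [iteratedDeriv_succ, ih]
    funext x
    have h1 : HasDerivAt (fun x : ℝ => (ξ : ℂ) * x * Complex.I) (ξ * Complex.I) x := by
      simpa using (((Complex.ofRealCLM.hasDerivAt (x := x)).const_mul (ξ : ℂ)).mul_const Complex.I)
    rw [(h1.cexp.const_mul _).deriv]
    ring

theorem contDiff_cexp_mul_I (ξ : ℝ) : ContDiff ℝ ∞ fun x : ℝ => Complex.exp (ξ * x * Complex.I) :=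
  ((contDiff_const.mul Complex.ofRealCLM.contDiff).mul contDiff_const).cexp

theorem scalarNorm_mul_cexp_le (p : ℕ) {χ g : 𝓢(ℝ, ℂ)} {ξ : ℝ}
    (hg : ∀ x, g x = χ x * Complex.exp (ξ * x * Complex.I)) :
    scalarNorm p g ≤ (p + 1) * (2 ^ p * scalarNorm p χ) * (1 + |ξ|) ^ p := by
  have hg' : (g : ℝ → ℂ) = fun x => χ x * Complex.exp (ξ * x * Complex.I) := funext hg
  have hχ := scalarNorm_nonneg p χ
  refine (scalarNorm_le (B := 2 ^ p * scalarNorm p χ * (1 + |ξ|) ^ p) (by positivity)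
    fun l hl x => ?_).trans_eq (by ring)
  rw [hg']
  refine (norm_iteratedFDeriv_mul_le (χ.smooth ⊤) (contDiff_cexp_mul_I ξ) x (n := l)
    (mod_cast le_top)).trans ?_
  calc ∑ i ∈ Finset.range (l + 1), (l.choose i : ℝ) * ‖iteratedFDeriv ℝ i χ x‖ *
        ‖iteratedFDeriv ℝ (l - i) (fun x : ℝ => Complex.exp (ξ * x * Complex.I)) x‖
      ≤ ∑ i ∈ Finset.range (l + 1), (l.choose i : ℝ) * scalarNorm p χ * (1 + |ξ|) ^ p := by
        refine Finset.sum_le_sum fun i hi => ?_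
        have hi' : i ≤ l := Nat.lt_succ_iff.mp (Finset.mem_range.mp hi)
        have h1 := norm_iteratedFDeriv_le_scalarNorm (hi'.trans hl) χ x
        have h2 : ‖iteratedFDeriv ℝ (l - i) (fun x : ℝ => Complex.exp (ξ * x * Complex.I)) x‖ ≤
            (1 + |ξ|) ^ p := by
          have h3 : ‖Complex.exp (ξ * x * Complex.I)‖ = 1 := by
            rw [← Complex.ofReal_mul, Complex.norm_exp_ofReal_mul_I]
          rw [norm_iteratedFDeriv_eq_norm_iteratedDeriv, iteratedDeriv_cexp_mul_I, norm_mul, h3,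
            mul_one, norm_pow, norm_mul, Complex.norm_I, mul_one, Complex.norm_real,
            Real.norm_eq_abs]
          calc |ξ| ^ (l - i) ≤ (1 + |ξ|) ^ (l - i) := by gcongr; linarith
            _ ≤ (1 + |ξ|) ^ p := pow_le_pow_right₀ (by linarith [abs_nonneg ξ]) (by omega)
        gcongr
    _ = 2 ^ l * (scalarNorm p χ * (1 + |ξ|) ^ p) := by
        have h2 : (2 : ℝ) ^ l = ∑ i ∈ Finset.range (l + 1), (l.choose i : ℝ) := by
          exact_mod_cast (Nat.sum_range_choose l).symm
        rw [h2, Finset.sum_mul]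
        exact Finset.sum_congr rfl fun i _ => by ring
    _ ≤ 2 ^ p * scalarNorm p χ * (1 + |ξ|) ^ p := by
        rw [mul_assoc]
        gcongr
        norm_num

/-- Characters of `ℝ / 8ρℤ`, cut off to a ball. -/
theorem exists_modulated_cutoff {ρ : ℝ} (hρ : 2 ≤ ρ) :
    ∃ (E : ℤ → 𝓢(ℝ, ℂ)) (c : ℝ → ℂ) (B : ℕ → ℝ), (∀ x, |x| ≤ ρ → c x = 1) ∧
      (∀ k x, E k x = c x * Complex.exp (2 * Real.pi * Complex.I * k * (x / (8 * ρ) : ℝ))) ∧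
      (∀ k, tsupport (E k) ⊆ Metric.closedBall 0 (2 * ρ)) ∧ (∀ p, 0 ≤ B p) ∧
      ∀ p k, scalarNorm p (E k) ≤ B p * (1 + |(k : ℝ)|) ^ p := by
  obtain ⟨χ, c, hχ, -, -, hc, hs⟩ := exists_cutoff (δ := ρ) (by linarith)
  have hsub : ∀ ξ : ℝ, tsupport (fun x : ℝ => χ x * Complex.exp (ξ * x * Complex.I)) ⊆
      Metric.closedBall 0 (2 * ρ) := fun ξ => (tsupport_mul_subset_left).trans hs
  have hcomp : ∀ ξ : ℝ, HasCompactSupport fun x : ℝ => χ x * Complex.exp (ξ * x * Complex.I) :=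
    fun ξ => (isCompact_closedBall _ _).of_isClosed_subset (isClosed_tsupport _) (hsub ξ)
  have hsm : ∀ ξ : ℝ, ContDiff ℝ ∞ fun x : ℝ => χ x * Complex.exp (ξ * x * Complex.I) :=
    fun ξ => (χ.smooth ⊤).mul (contDiff_cexp_mul_I ξ)
  refine ⟨fun k => (hcomp (2 * Real.pi * k / (8 * ρ))).toSchwartzMap (hsm _), fun x => c x,
    fun p => (p + 1) * (2 ^ p * scalarNorm p χ), fun x hx => by simp only [hc x hx, Complex.ofReal_one],
    fun k x => ?_, fun k => hsub _, fun p => ?_, fun p k => ?_⟩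
  · change χ x * _ = _
    rw [hχ]
    congr 2
    push_cast
    ring
  · have := scalarNorm_nonneg p χ
    positivity
  · refine (scalarNorm_mul_cexp_le p (χ := χ) (ξ := 2 * Real.pi * k / (8 * ρ)) fun x => rfl).trans ?_
    have := scalarNorm_nonneg p χ
    refine mul_le_mul_of_nonneg_left (pow_le_pow_left₀ (by positivity) ?_ p) (by positivity)
    refine add_le_add le_rfl ?_
    rw [abs_div, abs_mul, abs_of_nonneg (by positivity : (0 : ℝ) ≤ 2 * Real.pi),
      abs_of_nonneg (by linarith : 0 ≤ 8 * ρ), div_le_iff₀ (by linarith), mul_comm]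
    -- The frequency 2πk/(8ρ) is at most |k| in absolute value, because 2π < 8 ≤ 8ρ.
    have := Real.pi_lt_four
    exact mul_le_mul_of_nonneg_left (by linarith) (abs_nonneg _)

end Modulation

/-! ### Rapidly converging product expansions. -/

section Expansion

variable {J : Type*} [Fintype J] [DecidableEq J]

theorem norm_partialDeriv_le_cNorm (ψ : 𝓢(J → ℝ, ℂ)) {m p : ℕ} (hm : m ≤ p) (s : Fin m → J)
    (x : J → ℝ) : ‖partialDeriv s ψ x‖ ≤ cNorm p ψ := by
  refine le_csSup ⟨∑ l ∈ Finset.range (p + 1), SchwartzMap.seminorm ℂ 0 l ψ, ?_⟩ ⟨m, hm, s, x, rfl⟩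
  rintro t ⟨l, hl, s, x, rfl⟩
  refine (norm_partialDeriv_le s _ x).trans ?_
  have h1 := SchwartzMap.le_seminorm ℂ 0 l ψ x
  rw [pow_zero, one_mul] at h1
  exact h1.trans (Finset.single_le_sum (f := fun l => SchwartzMap.seminorm ℂ 0 l ψ)
    (fun _ _ => apply_nonneg _ _) (Finset.mem_range.mpr (by omega)))

theorem partialDeriv_comp_smul (ψ : 𝓢(J → ℝ, ℂ)) {m : ℕ} (s : Fin m → J) (a : ℝ) (x : J → ℝ) :
    partialDeriv s (fun v => ψ (a • v)) x = a ^ m • partialDeriv s ψ (a • x) := by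
  unfold partialDeriv
  rw [iteratedFDeriv_comp_const_smul a (ψ.smooth m)]
  rfl

theorem integral_norm_partialDeriv_comp_smul_le {ψ : 𝓢(J → ℝ, ℂ)} {a : ℝ} (ha : 1 ≤ a)
    (hψ : tsupport ψ ⊆ Metric.closedBall 0 a) {m q : ℕ} (hm : m ≤ q) (s : Fin m → J) :
    ∫ v, ‖partialDeriv s (fun v => ψ (a • v)) v‖ ≤
      a ^ q * volume.real (Metric.closedBall (0 : J → ℝ) 1) * cNorm q ψ := by
  have hzero : ∀ v, v ∉ Metric.closedBall (0 : J → ℝ) 1 →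
      ‖partialDeriv s (fun v => ψ (a • v)) v‖ = 0 := by
    intro v hv
    rw [partialDeriv_comp_smul, norm_smul, mul_eq_zero]
    right
    have h1 : a • v ∉ tsupport ψ := fun h => by
      have h2 := mem_closedBall_zero_iff.mp (hψ h)
      rw [norm_smul, Real.norm_of_nonneg (by linarith)] at h2
      refine hv (mem_closedBall_zero_iff.mpr ?_)
      by_contra! h3
      nlinarith
    have h2 : iteratedFDeriv ℝ m ψ (a • v) = 0 := by
      by_contra h
      exact h1 (support_iteratedFDeriv_subset m h)
    simp [partialDeriv, h2]
  rw [← setIntegral_eq_integral_of_forall_compl_eq_zero hzero]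
  have h3 := norm_setIntegral_le_of_norm_le_const (μ := volume) (C := a ^ q * cNorm q ψ)
    (f := fun v => ‖partialDeriv s (fun v => ψ (a • v)) v‖)
    (isCompact_closedBall (0 : J → ℝ) 1).measure_lt_top fun v _ => by
      rw [norm_norm, partialDeriv_comp_smul, norm_smul, norm_pow,
        Real.norm_of_nonneg (by linarith)]
      have := norm_partialDeriv_le_cNorm ψ hm s (a • v)
      gcongr
  exact (le_abs_self _).trans (h3.trans_eq (by ring))

/-- For ‖n‖ ≤ 1 the trivial bound suffices. Otherwise differentiate along a coordinate that attains
‖n‖; in both cases 2^q absorbs the 1 in 1 + ‖n‖. -/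
theorem one_add_norm_pow_mul_norm_fourierCoeffFun_le {ψ : 𝓢(J → ℝ, ℂ)} {a : ℝ} (ha : 1 ≤ a)
    (hψ : tsupport ψ ⊆ Metric.closedBall 0 a) (q : ℕ) (n : J → ℤ) :
    (1 + ‖n‖) ^ q * ‖fourierCoeffFun (fun v => ψ (a • v)) fun j => (n j : ℝ)‖ ≤
      2 ^ q * (a ^ q * volume.real (Metric.closedBall (0 : J → ℝ) 1)) * cNorm q ψ := by
  have ha0 : a ≠ 0 := by linarith
  rcases le_or_gt ‖n‖ 1 with hn | hn
  · have h1 := integral_norm_partialDeriv_comp_smul_le ha hψ (Nat.zero_le q) Fin.elim0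
    simp only [partialDeriv, iteratedFDeriv_zero_apply] at h1
    have h2 := (norm_fourierCoeffFun_le (fun v => ψ (a • v)) fun j => (n j : ℝ)).trans h1
    rw [mul_assoc]
    gcongr
    linarith
  · obtain ⟨j, hj⟩ : ∃ j, ‖n‖ ≤ |(n j : ℝ)| := by
      by_contra! h
      exact lt_irrefl _ ((pi_norm_lt_iff (by linarith)).mpr fun j => by
        rw [Int.norm_eq_abs]; exact h j)
    have hg : ContDiff ℝ ∞ fun v => ψ (a • v) := (ψ.smooth ⊤).comp (contDiff_const_smul a)
    have hc : HasCompactSupport fun v => ψ (a • v) :=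
      (hasCompactSupport_of_subset_closedBall hψ).comp_smul ha0
    have h1 := (abs_pow_mul_norm_fourierCoeffFun_le hg hc (fun j => (n j : ℝ)) j q).trans
      (integral_norm_partialDeriv_comp_smul_le ha hψ le_rfl _)
    calc _ ≤ (2 * |(n j : ℝ)|) ^ q * ‖fourierCoeffFun (fun v => ψ (a • v)) fun j => (n j : ℝ)‖ := by
          gcongr; linarith
      _ = 2 ^ q * (|(n j : ℝ)| ^ q *
            ‖fourierCoeffFun (fun v => ψ (a • v)) fun j => (n j : ℝ)‖) := by ring
      _ ≤ 2 ^ q * (a ^ q * volume.real (Metric.closedBall (0 : J → ℝ) 1) * cNorm q ψ) := by gcongr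
      _ = _ := by ring

variable (J) in
/-- A test function supported in a ball is a rapidly converging sum of products of functions of one
variable. -/
theorem exists_product_expansion {ρ : ℝ} (hρ : 2 ≤ ρ) :
    ∃ (E : ℤ → 𝓢(ℝ, ℂ)) (A B : ℕ → ℝ), (∀ q, 0 ≤ A q) ∧ (∀ p, 0 ≤ B p) ∧
      (∀ k, tsupport (E k) ⊆ Metric.closedBall 0 (2 * ρ)) ∧
      (∀ p k, scalarNorm p (E k) ≤ B p * (1 + |(k : ℝ)|) ^ p) ∧
      ∀ ψ : 𝓢(J → ℝ, ℂ), tsupport ψ ⊆ Metric.closedBall 0 ρ →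
        ∃ c : (J → ℤ) → ℂ, (∀ q n, (1 + ‖n‖) ^ q * ‖c n‖ ≤ A q * cNorm q ψ) ∧
          ∀ x, HasSum (fun n => c n * ∏ j, E (n j) (x j)) (ψ x) := by
  obtain ⟨E, χ, B, hχ, hE, hsupp, hB, hEB⟩ := exists_modulated_cutoff hρ
  refine ⟨E, fun q => 2 ^ q * ((8 * ρ) ^ q * volume.real (Metric.closedBall (0 : J → ℝ) 1)), B,
    fun q => by positivity, hB, hsupp, hEB, fun ψ hψ => ?_⟩
  have h8 : 0 < 8 * ρ := by linarith
  -- Period 8ρ brings the support into the cube of half-side 1/8 required by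
  -- `hasSum_fourier_of_support`.
  set g : (J → ℝ) → ℂ := fun v => ψ ((8 * ρ) • v) with hgdef
  have hdecay := one_add_norm_pow_mul_norm_fourierCoeffFun_le (by linarith : 1 ≤ 8 * ρ)
    (hψ.trans (Metric.closedBall_subset_closedBall (by linarith)))
  have hnorm : ∀ x, ψ x ≠ 0 → ‖x‖ ≤ ρ := fun x hx =>
    mem_closedBall_zero_iff.mp (hψ (subset_tsupport _ hx))
  refine ⟨fun n => fourierCoeffFun g fun j => (n j : ℝ), hdecay, fun x => ?_⟩
  obtain ⟨N, hN⟩ := exists_summable_inv_one_add_norm_pow (J := J)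
  have hsum : Summable fun n : J → ℤ => fourierCoeffFun g fun j => (n j : ℝ) := by
    refine Summable.of_norm_bounded (hN.mul_left (2 ^ N * ((8 * ρ) ^ N *
      volume.real (Metric.closedBall (0 : J → ℝ) 1)) * cNorm N ψ)) fun n => ?_
    rw [← div_eq_mul_inv, le_div_iff₀ (by positivity), mul_comm]
    exact hdecay N n
  have hcoord : ∀ x, ψ x ≠ 0 → ∀ j, |x j| ≤ ρ := fun x hx j =>
    (norm_le_pi_norm x j).trans (hnorm x hx)
  -- The Fourier series represents ψ on one period cell only. Outside the cell both sides vanish,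
  -- since the cutoffs are supported in [-2ρ, 2ρ].
  by_cases hx : ∀ j, |x j| ≤ 4 * ρ
  · have key := hasSum_fourier_of_support (g := g) (x := fun j => x j / (8 * ρ))
      (ψ.continuous.comp (continuous_const_smul _)) (fun v hv j => by
        have := hcoord _ hv j
        rw [Pi.smul_apply, smul_eq_mul, abs_mul, abs_of_pos h8] at this
        by_contra! h
        nlinarith) hsum fun j => by
        rw [abs_div, abs_of_pos h8, div_le_iff₀ h8]
        linarith [hx j]
    have hgx : g (fun j => x j / (8 * ρ)) = ψ x := by
      refine congrArg ψ (funext fun j => ?_)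
      simp only [Pi.smul_apply, smul_eq_mul]
      field_simp
    rw [hgx] at key
    have hψx : ψ x * ∏ j, χ (x j) = ψ x := by
      by_cases h0 : ψ x = 0
      · rw [h0, zero_mul]
      · rw [Finset.prod_eq_one fun j _ => hχ _ (hcoord x h0 j), mul_one]
    have h2 := key.mul_right (∏ j, χ (x j))
    rw [hψx] at h2
    refine h2.congr_fun ?_
    intro n
    rw [Finset.prod_congr rfl fun j _ => hE (n j) (x j), Finset.prod_mul_distrib]
    ring
  · push Not at hx
    obtain ⟨j, hj⟩ := hx
    have h0 : ψ x = 0 := by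
      by_contra h
      linarith [hcoord x h j]
    have h1 : ∀ k, E k (x j) = 0 := by
      intro k
      by_contra h
      have := mem_closedBall_zero_iff.mp (hsupp k (subset_tsupport _ h))
      rw [Real.norm_eq_abs] at this
      linarith
    rw [h0]
    convert hasSum_zero using 2 with n
    rw [Finset.prod_eq_zero (Finset.mem_univ j) (h1 _), mul_zero]

end Expansion

/-! ### From products to arbitrary test functions. -/

section Synthesis

variable {J : Type*} [Fintype J] [DecidableEq J]

theorem seminorm_prod_le {f : J → 𝓢(ℝ, ℂ)} {ψ : 𝓢(J → ℝ, ℂ)} {ρ : ℝ} (hρ : 0 ≤ ρ)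
    (hf : ∀ j, tsupport (f j) ⊆ Metric.closedBall 0 ρ) (hψ : ∀ x, ψ x = ∏ j, f j (x j))
    (k l : ℕ) : SchwartzMap.seminorm ℂ k l ψ ≤
      ρ ^ k * (∑ q ∈ (Finset.univ : Finset J).sym l, ((q : Multiset J).countPerms : ℝ)) *
        ∏ j, scalarNorm l (f j) := by
  have h0 : 0 ≤ ∏ j, scalarNorm l (f j) := Finset.prod_nonneg fun j _ => scalarNorm_nonneg _ _
  have h1 : (0 : ℝ) ≤ ∑ q ∈ (Finset.univ : Finset J).sym l, ((q : Multiset J).countPerms : ℝ) :=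
    Finset.sum_nonneg fun _ _ => Nat.cast_nonneg _
  refine SchwartzMap.seminorm_le_bound ℂ k l ψ (by positivity) fun x => ?_
  by_cases hx : x ∈ tsupport ψ
  · have h2 : ‖x‖ ≤ ρ := mem_closedBall_zero_iff.mp (tsupport_prod_subset hρ hf hψ hx)
    have h3 := norm_iteratedFDeriv_prod_scalar_le f (le_refl l) x
    rw [← funext hψ] at h3
    rw [mul_assoc]
    gcongr
  · have h2 : iteratedFDeriv ℝ l ψ x = 0 := by
      by_contra h
      exact hx (support_iteratedFDeriv_subset l h)
    rw [h2, norm_zero, mul_zero]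
    positivity

/-- Each coordinate costs (1 + ‖n‖)^p. Decay of the coefficient to order p·card J + N pays for all
of them and leaves a summable factor. -/
theorem norm_mul_prod_scalarNorm_le {E : ℤ → 𝓢(ℝ, ℂ)} {B : ℕ → ℝ} (hB : ∀ p, 0 ≤ B p)
    (hE : ∀ p k, scalarNorm p (E k) ≤ B p * (1 + |(k : ℝ)|) ^ p) (p N : ℕ) (n : J → ℤ) {c : ℂ}
    {D : ℝ} (hc : (1 + ‖n‖) ^ (p * Fintype.card J + N) * ‖c‖ ≤ D) :
    ‖c‖ * ∏ j, scalarNorm p (E (n j)) ≤ B p ^ Fintype.card J * D * ((1 + ‖n‖) ^ N)⁻¹ := by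
  have h1 : ∏ j, scalarNorm p (E (n j)) ≤ ∏ _j : J, B p * (1 + ‖n‖) ^ p := by
    refine Finset.prod_le_prod (fun j _ => scalarNorm_nonneg _ _) fun j _ => (hE p (n j)).trans ?_
    have h2 := norm_le_pi_norm n j
    rw [Int.norm_eq_abs] at h2
    have := hB p
    gcongr
  rw [Finset.prod_const, Finset.card_univ, mul_pow, ← pow_mul] at h1
  rw [← div_eq_mul_inv, le_div_iff₀ (by positivity)]
  have := hB p
  calc ‖c‖ * (∏ j, scalarNorm p (E (n j))) * (1 + ‖n‖) ^ N
      ≤ ‖c‖ * (B p ^ Fintype.card J * (1 + ‖n‖) ^ (p * Fintype.card J)) * (1 + ‖n‖) ^ N := by gcongr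
    _ = B p ^ Fintype.card J * ((1 + ‖n‖) ^ (p * Fintype.card J + N) * ‖c‖) := by ring
    _ ≤ _ := by gcongr

variable {ι κ : Type*} [Fintype ι] [LinearOrder κ] [DecidableEq ι] [Fintype κ]
  {blk : ι → κ} {d : ι → ℝ}

/-- For fixed φ the tensor product is continuous in the other factor: exchange the roles of the two
factors in `tensorCLM`. -/
theorem hasSum_sharp {α : Type*} (K : 𝓢'(ι → ℝ, ℂ)) (M : Finset κ) (R : {k // k ∈ M} → ℝ)
    (hR : ∀ k, 0 < R k) {a : α → 𝓢(CoordIn blk M → ℝ, ℂ)} {ψ : 𝓢(CoordIn blk M → ℝ, ℂ)}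
    (h : HasSum a ψ) (φ : 𝓢(CoordOut blk M → ℝ, ℂ)) :
    HasSum (fun n => sharp blk d K M R hR (a n) φ) (sharp blk d K M R hR ψ φ) := by
  have hproj : ∀ x, ‖x‖ ≤ ‖projIn blk M x‖ + ‖projOut blk M x‖ := fun x =>
    (norm_le_projOut_add_projIn blk M x).trans_eq (add_comm _ _)
  have hswap : ∀ ψ, sharp blk d K M R hR ψ φ =
      K (tensorCLM (projIn blk M) (projOut blk M) hproj φ (dilate blk d M R hR ψ)) := by
    intro ψ
    rw [sharp_apply]
    congr 1
    ext x
    exact mul_comm _ _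
  simp only [hswap]
  have h1 := h.mapL (SchwartzMap.compCLMOfContinuousLinearEquiv ℂ
    (dilation (blkIn blk M) (fun j => d j) R hR))
  have h2 := h1.mapL (tensorCLM (projIn blk M) (projOut blk M) hproj φ)
  exact h2.map K (map_continuous K)

/-- Apply the product condition to each term of the expansion and sum. The products are supported in
a ball of radius 2ρ, hence the doubled radius; the order of the norm of ψ is the one that
`norm_mul_prod_scalarNorm_le` demands. -/
theorem cancellation_of_productCancellation (hd : ∀ j, 0 < d j) {K : 𝓢'(ι → ℝ, ℂ)}
    (hK : ∀ M, ProductCancellation blk d K M fun _ => True) :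
    Cancellation blk d (fun _ _ => True) K := by
  intro M ρ₀
  obtain ⟨ρ, hρ, hρ₀⟩ : ∃ ρ, 2 ≤ ρ ∧ ρ₀ ≤ ρ := ⟨max 2 ρ₀, le_max_left _ _, le_max_right _ _⟩
  obtain ⟨E, A, B, hA, hB, hsupp, hE, hexp⟩ := exists_product_expansion (CoordIn blk M) hρ
  obtain ⟨C, p, hC, hprod⟩ := hK M (2 * ρ) (by linarith)
  obtain ⟨N, hN⟩ := exists_summable_inv_one_add_norm_pow (J := CoordIn blk M)
  set ν := Fintype.card (CoordIn blk M)
  refine ⟨fun m s => C m s * (B (p m s) ^ ν * A (p m s * ν + N)) *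
    ∑' n : CoordIn blk M → ℤ, ((1 + ‖n‖) ^ N)⁻¹, fun m s => p m s * ν + N,
    fun ψ hψ R hR _ => ?_⟩
  obtain ⟨c, hc, hsum⟩ := hexp ψ (hψ.trans (Metric.closedBall_subset_closedBall hρ₀))
  choose Ψ hΨ using fun n : CoordIn blk M → ℤ =>
    exists_schwartz_prod (f := fun j => E (n j)) (by linarith : 0 ≤ 2 * ρ) fun j => hsupp (n j)
  have hconv : HasSum (fun n => c n • Ψ n) ψ := by
    refine hasSum_schwartz (fun k l => ?_) fun x => ?_
    · refine Summable.of_nonneg_of_le (fun n => apply_nonneg _ _) (fun n => ?_)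
        ((hN.mul_left (B l ^ ν * (A (l * ν + N) * cNorm (l * ν + N) ψ))).mul_left ((2 * ρ) ^ k *
          ∑ q ∈ (Finset.univ : Finset (CoordIn blk M)).sym l, ((q : Multiset (CoordIn blk M)).countPerms : ℝ)))
      rw [map_smul_eq_mul]
      calc _ ≤ ‖c n‖ * _ := mul_le_mul_of_nonneg_left
            (seminorm_prod_le (by linarith) (fun j => hsupp (n j)) (hΨ n) k l) (norm_nonneg _)
        _ = _ * (‖c n‖ * ∏ j, scalarNorm l (E (n j))) := mul_left_comm _ _ _
        _ ≤ _ := mul_le_mul_of_nonneg_left (norm_mul_prod_scalarNorm_le hB hE l N n (hc _ n))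
            (mul_nonneg (by positivity) (Finset.sum_nonneg fun _ _ => Nat.cast_nonneg _))
    · simpa only [smul_apply, smul_eq_mul, hΨ] using hsum x
  have hterm : ∀ n, DiffIneqWith (blkOut blk M) (fun j => d j)
      (sharp blk d K M R hR (c n • Ψ n)) fun m s =>
        C m s * (B (p m s) ^ ν * (A (p m s * ν + N) * cNorm (p m s * ν + N) ψ)) *
          ((1 + ‖n‖) ^ N)⁻¹ := by
    intro n
    refine ((hprod (fun j => E (n j)) (fun j => hsupp (n j)) R hR trivial (Ψ n) (hΨ n)).smul
      (T := sharp blk d K M R hR (c n • Ψ n)) (c n) fun φ => ?_).mono fun m s => ?_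
    · rw [sharp_apply, sharp_apply, ← smul_eq_mul, ← map_smul]
      congr 1
      ext x
      simp only [smul_apply, tensorCLM_apply, dilate, map_smul, smul_eq_mul]
      ring
    · rw [mul_left_comm, mul_assoc]
      exact mul_le_mul_of_nonneg_left (norm_mul_prod_scalarNorm_le hB hE _ N n (hc _ n)) (hC m s)
  refine (diffIneqWith_tsum (d := fun j : CoordOut blk M => d j) (fun j => hd j) hterm (fun m s => hN.mul_left _)
    (hasSum_sharp (d := d) K M R hR hconv)).mono fun m s => ?_
  rw [tsum_mul_left]
  exact le_of_eq (by ring)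

end Synthesis

end

end FlagKernel

theorem mainTheorem5 {N n : ℕ} (d : Fin N → ℝ) (hd : ∀ j, 0 < d j) (hd_mono : Monotone d)
    (blk : Fin N → Fin n) (hblk_mono : Monotone blk) (hblk_surj : Function.Surjective blk)
    (K : 𝓢'(Fin N → ℝ, ℂ)) (hK : FlagKernel.IsRestrictedFlagKernel blk d K) :
    FlagKernel.IsFlagKernel blk d K := by
  refine ⟨hK.1, FlagKernel.cancellation_of_productCancellation hd ?_⟩
  exact FlagKernel.productCancellation_of_antitone hd hblk_surj fun M => 
    FlagKernel.Cancellation.productCancellation blk d hK.2 M
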